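/- All spaces are compactly generated Hausdorff, and products and mapping spaces carry the compactly generated topology. **Trees.** For $n\ge 2$ let $K_n$ be the space of planar rooted metric trees with $n$ leaves, in which every vertex has at least two inputs and every internal edge has a length in $[0,1]$, where edges of length $0$ are collapsed; $K_0$ and $K_1$ are points, $K_1=\{\delta_1\}$ with $\delta_1$ the tree without vertices, and $\delta_n\in K_n$ ($n\ge2$) is the tree without internal edges. For $T\in K_n$, $S\in K_m$, $m\ge 1$, $T\circ_i^r S\in K_{n+m-1}$ is the tree obtained by grafting the root of $S$ to the $i$-th leaf of $T$, the new edge having length $r$; $T\circ_i S=T\circ_i^1S$; and $s_i:K_n\to K_{n-1}$, $s_i(T)=T\circ_i\delta_0$, erases the $i$-th leaf (if a vertex is left with one input it is erased, and two internal edges that are merged get the maximum of their lengths). This makes $\{K_n\}_{n\ge0}$ an operad. An $A_\infty$-space is an algebra $(X,\{M_n:K_n\times X^n\to X\}_{n\ge0})$ over it. A (left) $A_\infty$-action of $X$ on $P$ is a family of maps $N_k:K_k\times X^{k-1}\times P\to P$, $k\ge1$, with $N_1=\mathrm{id}$, $N(\rho\circ_j\tau;x,p)=N(\rho;\dots,M(\tau;\dots),\dots,p)$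 for $j<|\rho|$, $|\tau|\ge0$, and $N(\rho\circ_{|\rho|}\tau;x,y,p)=N(\rho;x,N(\tau;y,p))$. **Equivariance.** An $A_\infty$-map from $X$ to a topological monoid $Y$ is a family of maps $f_n:K_{n+1}\times X^n\to Y$, $n\ge1$, such that, for $|\rho|,|\tau|\ge2$, $f(\rho\circ_{j+1}\tau;x)=f(\rho;x_1,\dots,x_{j-1},M(\tau;x_j,\dots),\dots)$ for $1\le j<|\rho|$, and $f(\rho\circ_1\tau;x,y)=f(\tau;x)\cdot f(\rho;y)$. If $Y$ acts on $Q$, a map $F:P\to Q$ is $A_\infty$-equivariant with respect to $\{f_n\}$ if there are maps $F_n:K_{n+1}\times X^{n-1}\times P\to Q$, $n\ge1$, with $F_1=F$ and, for $\tau\in K_{i+1}$, $\rho\in K_{j+1}$, $i,j\ge1$, $n=i+j$, $$F_n(\tau\circ_k\rho;x_1,\dots,x_{n-1},p)=\begin{cases}F_i(\tau;x_1,\dots,x_{k-2},M_{j+1}(\rho;x_{k-1},\dots,x_{k+j-1}),x_{k+j},\dots,x_{n-1},p)&2\le k\le i,\\ F_i(\tau;x_1,\dots,x_{i-1},N_{j+1}(\rho;x_i,\dots,x_{n-1},p))&k=i+1,\\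 f_j(\rho;x_1,\dots,x_j)\cdot F_i(\tau;x_{j+1},\dots,x_{n-1},p)&k=1.\end{cases}$$ **Bar construction.** $P/\!/X=B(*,X,P)$ is the quotient of $\coprod_{n\ge0}K_{n+2}\times X^n\times P$ by the relations $[\rho\circ_1\tau;*,x,y,p]=[\rho;*,y,p]$, $[\rho\circ_{i}\tau;*,x,p]=[\rho;*,\dots,M(\tau;\dots),\dots,p]$ ($1<i<|\rho|$) and $[\rho\circ_{|\rho|}\tau;*,x,y,p]=[\rho;*,x,N(\tau;y,p)]$, where $|\tau|\ge1$; $BX=*/\!/X$ for the trivial action. $CP=P\times[0,1]/P\times\{0\}$ is the unreduced cone, with the action $N(T;x,[p,t])=[N(T;x,p),t]$. The inclusions of the tip and of the base $p\mapsto[p,1]$ of the cone induce $\iota:BX\to CP/\!/X$ and $P/\!/X\to CP/\!/X$. The base points are $[\delta_2;*,*]\in BX$ and its image in $CP/\!/X$. $\Omega_M(B)$ denotes the monoid of Moore loops $(\gamma,r)$ (with $\gamma:[0,\infty)\to B$ constant from time $r$ on) at the base point; it acts by juxtaposition on the space $\Omega_M(B,A)$ of Moore paths from the base point to a point of $A$,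 where for $(B,A)=(CP/\!/X,P/\!/X)$ the subspace $A$ is the image of $P/\!/X$. **Sliding paths.** For $T\in K_n$, $n\ge2$, let $l(T)=2(1+\sum u_r)$, where $u_r$ runs over the lengths of the internal edges on the way from the first leaf to the root. Let $\sigma(T)$ be the Moore path in $K_{n+1}$ of length $l(T)$ obtained as follows: the root edge of $T$ becomes the last leaf, and a new root edge slides along $T$ from the first leaf (where it starts at distance $1$ from the vertex next to that leaf) to the former root edge (where it ends at distance $1$ from the former root vertex); it stays for a time $2u$ on an internal edge of length $u$, which meanwhile is divided into two edges of lengths $(s,u)$, $0\le s\le u$, and then $(u,2u-s)$, $u\le s\le 2u$. Thus $\sigma(\delta_2)(t)=\delta_2\circ_2^{1-t}\delta_2$ and $\sigma(\delta_2)(1+t)=\delta_2\circ_1^{t}\delta_2$ for $0\le t\le1$. Let $\lambda(T)$ be the Moore path $t\mapsto s_{n+1}(\sigma(T)(t))$ in $K_n$, of length $l(T)-1$ if the root vertex has more than two inputs and $l(T)-1-\min(u,v)$ if it has two inputs, coming from edges of lengths $u$ and $v$ (leaves counting as edges of length $1$); it ends in $T$ and is constant from that time on. **Proposition.** Let $X$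 be an $A_\infty$-space with an $A_\infty$-action on a nonempty space $P$. Then $f_n(T;x)(t)=[\sigma(T)(t);*,x,*]$ (a loop of length $l(T)$) defines an $A_\infty$-map $X\to\Omega_M(BX)$, whose first term is the usual map $x\mapsto[\sigma(\delta_2)(t);*,x,*]$, and the composition with $\Omega_M(\iota)$ is an $A_\infty$-map $X\to\Omega_M(BX)\to\Omega_M(CP/\!/X)$. The natural map $$P\to\Omega_M(CP/\!/X,\,P/\!/X),\qquad p\mapsto\gamma_p,\qquad \gamma_p(t)=[\delta_2;*,[p,t]]\quad(0\le t\le1),$$ where $\gamma_p$ has length $1$, is $A_\infty$-equivariant with respect to this composite $A_\infty$-map. The maps $F_n$ can be taken to be the juxtapositions $$F_n(T;x,p)=\big(t\mapsto[\lambda(T)(t);*,x,[p,0]]\big)\cdot\big(t\mapsto[T;*,x,[p,t]]\big),$$ the second path having length $1$. -/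

import Mathlib

open scoped NNReal unitInterval

universe u

/-! ## Metric trees

A planar rooted tree with leaves `1, …, n`, all of whose vertices have at least two inputs, is
determined by its set of internal edges, and an internal edge is determined by the interval
`{a, …, b}` of leaves lying above it.  The intervals that occur have at least two elements, are
different from `{1, …, n}` and are pairwise nested or disjoint; conversely every such set of
intervals comes from exactly one tree. -/

/-- `{a, …, b}` can be the set of leaves above an internal edge of a tree with `n` leaves. -/
def IsCluster (n a b : ℕ) : Prop := 1 ≤ a ∧ a < b ∧ b ≤ n ∧ ¬(a = 1 ∧ b = n)

/-- The intervals `{a, …, b}` and `{c, …, d}` are disjoint or nested. -/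
def Compat (a b c d : ℕ) : Prop := b < c ∨ d < a ∨ (a ≤ c ∧ d ≤ b) ∨ (c ≤ a ∧ b ≤ d)

/-- A planar tree with `n` leaves (vertices with at least two inputs), as its set of internal
edges. -/
@[ext]
structure PlanarTree (n : ℕ) where
  edges : Finset (ℕ × ℕ)
  isCluster : ∀ e ∈ edges, IsCluster n e.1 e.2
  laminar : ∀ e ∈ edges, ∀ e' ∈ edges, Compat e.1 e.2 e'.1 e'.2

/-- Contraction of the edge `e` of a planar tree. -/
def PlanarTree.contract {n : ℕ} (E : PlanarTree n) (e : ℕ × ℕ) : PlanarTree n where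
  edges := E.edges.erase e
  isCluster e' h := E.isCluster e' (Finset.mem_of_mem_erase h)
  laminar e' h e'' h' :=
    E.laminar e' (Finset.mem_of_mem_erase h) e'' (Finset.mem_of_mem_erase h')

/-- The space of edge-labeled trees with `n` leaves: the disjoint union over all planar trees of
the cubes of labelings of the internal edges by numbers in `[0, 1]`. -/
abbrev LabeledTree (n : ℕ) : Type := Σ E : PlanarTree n, (E.edges → I)

/-- A labeled tree with an edge of length `0` is identified with the tree in which that edge is
collapsed. -/
inductive Collapse {n : ℕ} : LabeledTree n → LabeledTree n → Prop
  | mk (E : PlanarTree n) (l : E.edges → I) (e : E.edges) (he : l e = 0) :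
      Collapse ⟨E, l⟩ ⟨E.contract e, fun e' => l ⟨e', Finset.mem_of_mem_erase e'.2⟩⟩

/-- A metric tree with `n` leaves, i.e. a point of the associahedron `K_n`: the length of each
internal edge, with an absent edge recorded as an edge of length `0`. For `n ≤ 1` there is exactly
one such tree.  `MTree.isQuotientMap_ofLabeled` and `MTree.ofLabeled_eq_iff` show that this is the
quotient of the space of edge-labeled trees by the collapsing of edges of length `0`. -/
@[ext]
structure MTree (n : ℕ) where
  len : ℕ → ℕ → ℝ
  nonneg : ∀ a b, 0 ≤ len a b
  le_one : ∀ a b, len a b ≤ 1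
  isCluster : ∀ a b, len a b ≠ 0 → IsCluster n a b
  laminar : ∀ a b c d, len a b ≠ 0 → len c d ≠ 0 → Compat a b c d

namespace MTree

instance (n : ℕ) : TopologicalSpace (MTree n) := TopologicalSpace.induced MTree.len inferInstance

/-- The metric tree of an edge-labeled tree. -/
def ofLabeled {n : ℕ} (t : LabeledTree n) : MTree n where
  len a b := if h : (a, b) ∈ t.1.edges then (t.2 ⟨(a, b), h⟩ : ℝ) else 0
  nonneg a b := by
    split_ifs
    · exact (t.2 _).2.1
    · exact le_rfl
  le_one a b := by
    split_ifs
    · exact (t.2 _).2.2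
    · exact zero_le_one
  isCluster a b h := by
    by_cases h' : (a, b) ∈ t.1.edges
    · exact t.1.isCluster _ h'
    · simp [h'] at h
  laminar a b c d h h' := by
    by_cases h1 : (a, b) ∈ t.1.edges
    · by_cases h2 : (c, d) ∈ t.1.edges
      · exact t.1.laminar _ h1 _ h2
      · simp [h2] at h'
    · simp [h1] at h

/-- The edges of positive length of a metric tree. -/
noncomputable def support {n : ℕ} (T : MTree n) : PlanarTree n where
  edges := {e ∈ Finset.range (n + 1) ×ˢ Finset.range (n + 1) | T.len e.1 e.2 ≠ 0}
  isCluster _ h := T.isCluster _ _ (Finset.mem_filter.1 h).2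
  laminar _ h _ h' := T.laminar _ _ _ _ (Finset.mem_filter.1 h).2 (Finset.mem_filter.1 h').2

lemma mem_support {n : ℕ} (T : MTree n) (e : ℕ × ℕ) : e ∈ T.support.edges ↔ T.len e.1 e.2 ≠ 0 := by
  simp only [support, Finset.mem_filter, Finset.mem_product, Finset.mem_range, and_iff_right_iff_imp]
  intro h
  have := T.isCluster _ _ h
  unfold IsCluster at this
  omega

/-- The labeled tree without edges of length `0` that represents a metric tree. -/
noncomputable def toLabeled {n : ℕ} (T : MTree n) : LabeledTree n :=
  ⟨T.support, fun e => ⟨T.len e.1.1 e.1.2, T.nonneg _ _, T.le_one _ _⟩⟩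

lemma ofLabeled_toLabeled {n : ℕ} (T : MTree n) : ofLabeled T.toLabeled = T := by
  ext a b
  by_cases h : T.len a b = 0
  · have : (a, b) ∉ T.support.edges := by simp [mem_support, h]
    simp [ofLabeled, toLabeled, this, h]
  · have : (a, b) ∈ T.support.edges := by simp [mem_support, h]
    simp [ofLabeled, toLabeled, this]

lemma ofLabeled_eq_of_collapse {n : ℕ} {s t : LabeledTree n} (h : Collapse s t) :
    ofLabeled s = ofLabeled t := by
  obtain ⟨E, l, e, he⟩ := h
  ext a b
  by_cases h : (a, b) ∈ E.edges
  · by_cases h' : (a, b) = e.1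
    · have : l ⟨(a, b), h⟩ = 0 := by rw [← he]; congr 1; exact Subtype.ext h'
      simp [ofLabeled, PlanarTree.contract, h, this]
    · simp [ofLabeled, PlanarTree.contract, h, h']
  · simp [ofLabeled, PlanarTree.contract, h]

lemma eqvGen_toLabeled {n : ℕ} (k : ℕ) (t : LabeledTree n) (hk : t.1.edges.card = k) :
    Relation.EqvGen Collapse t (ofLabeled t).toLabeled := by
  induction k generalizing t with
  | zero =>
    obtain ⟨E, l⟩ := t
    have hE : E.edges = ∅ := Finset.card_eq_zero.1 hk
    have : (⟨E, l⟩ : LabeledTree n) = (ofLabeled ⟨E, l⟩).toLabeled := by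
      have h0 : E = (ofLabeled (n := n) ⟨E, l⟩).support := by
        ext e
        simp [mem_support, ofLabeled, hE]
      refine Sigma.ext h0 ?_
      refine Function.hfunext (congrArg (fun E' : PlanarTree n => (E'.edges : Type)) h0) ?_
      rintro ⟨e, h⟩
      simp [hE] at h
    rw [← this]
    exact Relation.EqvGen.refl _
  | succ k ih =>
    by_cases h : ∃ e, t.2 e = 0
    · obtain ⟨E, l⟩ := t
      obtain ⟨e, he⟩ := h
      have h1 := Collapse.mk E l e he
      rw [ofLabeled_eq_of_collapse h1]
      refine Relation.EqvGen.trans _ _ _ (Relation.EqvGen.rel _ _ h1) (ih _ ?_)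
      simp only [PlanarTree.contract]
      rw [Finset.card_erase_of_mem e.2, hk]
      rfl
    · push Not at h
      obtain ⟨E, l⟩ := t
      have : (⟨E, l⟩ : LabeledTree n) = (ofLabeled ⟨E, l⟩).toLabeled := by
        have h0 : E = (ofLabeled (n := n) ⟨E, l⟩).support := by
          ext e
          rw [mem_support]
          by_cases he : e ∈ E.edges
          · have := h ⟨e, he⟩
            simp only [ofLabeled, he, Prod.mk.eta, dite_true, ne_eq, true_iff]
            exact fun h' => this (Subtype.ext h')
          · simp [ofLabeled, he]
        refine Sigma.ext h0 ?_
        refine Function.hfunext (congrArg (fun E' : PlanarTree n => (E'.edges : Type)) h0) ?_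
        rintro ⟨e, h⟩ ⟨e', h'⟩ hee
        have : e = e' := by
          have hh : ∀ (E' : PlanarTree n) (h' : e' ∈ E'.edges), E = E' →
              HEq (⟨e, h⟩ : E.edges) (⟨e', h'⟩ : E'.edges) → e = e' := by
            rintro _ h' rfl h
            simpa using h
          exact hh _ h' h0 hee
        subst this
        refine heq_of_eq (Subtype.ext ?_)
        simp only [toLabeled, ofLabeled]
        have h2 : e ∈ E.edges := h
        simp [h2]
      rw [← this]
      exact Relation.EqvGen.refl _

/-- Two edge-labeled trees define the same metric tree iff they are identified by collapsing edges
of length `0`. -/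
theorem ofLabeled_eq_iff {n : ℕ} (s t : LabeledTree n) :
    ofLabeled s = ofLabeled t ↔ Relation.EqvGen Collapse s t := by
  constructor
  · intro h
    have h1 := eqvGen_toLabeled _ s rfl
    rw [h] at h1
    exact h1.trans _ _ _ (eqvGen_toLabeled _ t rfl).symm
  · intro h
    induction h with
    | rel _ _ h => exact ofLabeled_eq_of_collapse h
    | refl _ => rfl
    | symm _ _ _ ih => exact ih.symm
    | trans _ _ _ _ _ ih ih' => exact ih.trans ih'

instance (n : ℕ) : Finite (PlanarTree n) := by
  refine Finite.of_injective
    (fun E => (⟨E.edges, ?_⟩ : {s : Finset (ℕ × ℕ) //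
      s ∈ (Finset.range (n + 1) ×ˢ Finset.range (n + 1)).powerset})) ?_
  · rw [Finset.mem_powerset]
    intro e he
    have := E.isCluster e he
    unfold IsCluster at this
    simp only [Finset.mem_product, Finset.mem_range]
    omega
  · intro E E' h
    exact PlanarTree.ext (congrArg Subtype.val h)

instance (n : ℕ) : T2Space (MTree n) :=
  T2Space.of_injective_continuous (f := MTree.len) (fun _ _ h => MTree.ext h)
    continuous_induced_dom

/-- The space of metric trees has the quotient topology from the space of edge-labeled trees. -/
theorem isQuotientMap_ofLabeled (n : ℕ) :
    Topology.IsQuotientMap (ofLabeled : LabeledTree n → MTree n) := by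
  have hc : Continuous (ofLabeled : LabeledTree n → MTree n) := by
    refine continuous_induced_rng.2 (continuous_sigma fun E => ?_)
    refine continuous_pi fun a => continuous_pi fun b => ?_
    simp only [Function.comp_def, ofLabeled]
    by_cases h : (a, b) ∈ E.edges
    · simp only [h, dite_true]
      exact continuous_subtype_val.comp (continuous_apply (⟨(a, b), h⟩ : E.edges))
    · simp only [h, dite_false]
      fun_prop
  have : Function.Surjective (ofLabeled : LabeledTree n → MTree n) :=
    fun T => ⟨_, ofLabeled_toLabeled T⟩
  exact hc.isClosedMap.isQuotientMap hc this

/-- The corolla `δ_n`, the tree without internal edges. (For `n = 1` this is the tree without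
vertices, for `n = 0` the unique point of `K_0`.) -/
def corolla (n : ℕ) : MTree n where
  len _ _ := 0
  nonneg _ _ := le_rfl
  le_one _ _ := zero_le_one
  isCluster _ _ h := absurd rfl h
  laminar _ _ _ _ h := absurd rfl h

open Classical in
/-- The grafting `T ∘_i^r S`: the root of `S` is attached to the `i`-th leaf of `T`, and the new
edge gets length `r`. The leaves of `S` become the leaves `i, …, i + m - 1`. If `T` or `S` is the
tree without vertices, there is no new internal edge. -/
noncomputable def graft {n m N : ℕ} (r : I) (i : ℕ) (T : MTree n) (S : MTree m)
    (hi : 1 ≤ i ∧ i ≤ n := by omega) (hm : 1 ≤ m := by omega) (_hN : N + 1 = n + m := by omega) :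
    MTree N where
  len a b :=
    if ¬ IsCluster N a b then 0
    else if a = i ∧ b + 1 = i + m then r
    else if i ≤ a ∧ b + 1 ≤ i + m then S.len (a + 1 - i) (b + 1 - i)
    else if b < i ∨ i + m ≤ a ∨ (a ≤ i ∧ i + m ≤ b + 1) then
      T.len (if a ≤ i then a else a + 1 - m) (if b < i then b else b + 1 - m)
    else 0
  nonneg a b := by
    split_ifs
    all_goals first | exact le_rfl | exact r.2.1 | exact S.nonneg _ _ | exact T.nonneg _ _
  le_one a b := by
    split_ifs
    all_goals first | exact zero_le_one | exact r.2.2 | exact S.le_one _ _ | exact T.le_one _ _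
  isCluster a b h := by
    by_contra h'
    simp [h'] at h
  laminar a b c d h h' := by
    by_cases h1 : IsCluster N a b
    · by_cases h2 : IsCluster N c d
      · simp only [h1, h2, not_true_eq_false, if_false] at h h'
        have hS := S.laminar
        have hT := T.laminar
        unfold IsCluster Compat at *
        split_ifs at h h' <;> first
          | omega
          | exact absurd rfl h
          | exact absurd rfl h'
          | (have e1 := hS _ _ _ _ h h'; omega)
          | (have e1 := hT _ _ _ _ h h'; omega)
      · simp [h2] at h'
    · simp [h1] at h

open Classical in
/-- The degeneracy `s_i` erases the `i`-th leaf. If the vertex next to that leaf has exactly two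
inputs, it is erased too, and two internal edges that are merged in this way become one edge whose
length is the maximum of the two lengths. (The interval `{a, …, b}` of remaining leaves comes from
at most two intervals of original leaves, a smallest and a largest one.) -/
noncomputable def degen {m n : ℕ} (i : ℕ) (T : MTree m) (hm : m = n + 1 := by omega) :
    MTree n where
  len a b :=
    if IsCluster n a b then
      max (T.len (if a < i then a else a + 1) (if b < i then b else b + 1))
        (T.len (if a ≤ i then a else a + 1) (if b + 1 < i then b else b + 1))
    else 0
  nonneg a b := by
    split_ifs
    all_goals first | exact le_rfl | exact le_max_of_le_left (T.nonneg _ _)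
  le_one a b := by
    split_ifs
    all_goals first | exact zero_le_one | exact max_le (T.le_one _ _) (T.le_one _ _)
  isCluster a b h := by
    by_contra h'
    simp [h'] at h
  laminar a b c d h h' := by
    have key : ∀ x y : ℝ, max x y ≠ 0 → x ≠ 0 ∨ y ≠ 0 := by
      intro x y h
      by_contra hc
      push Not at hc
      simp [hc.1, hc.2] at h
    by_cases h1 : IsCluster n a b
    · by_cases h2 : IsCluster n c d
      · simp only [h1, h2, if_true] at h h'
        have hT := T.laminar
        subst hm
        unfold IsCluster Compat at *
        rcases key _ _ h with h | h <;> rcases key _ _ h' with h' | h' <;>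
        · have e1 := hT _ _ _ _ h h'
          split_ifs at e1 <;> omega
      · simp [h2] at h'
    · simp [h1] at h

/-! ### Sliding the root

For a tree `T` with `n` leaves, the edges on the way from the first leaf to the root are: the first
leaf, the internal edges with intervals `{1, …, b}` (`1 < b < n`, in increasing order), and the
root edge. -/

/-- The length of the edge with interval `{1, …, b}`; the first leaf and the root edge count as
edges of length `1`. -/
noncomputable def spine {n : ℕ} (T : MTree n) (b : ℕ) : ℝ :=
  if b = 1 ∨ b = n then 1 else T.len 1 b

/-- The length `l(T) = 2 (1 + ∑ u_r)` of a tree, where the `u_r` are the lengths of the internal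
edges on the way from the first leaf to the root. -/
noncomputable def slideLength {n : ℕ} (T : MTree n) : ℝ :=
  2 * (1 + ∑ b ∈ Finset.Ico 2 n, T.len 1 b)

/-- The amount of time (between `0` and twice the length of that edge) that the sliding path at
time `t` has spent on the edge with interval `{1, …, b}`. The path starts in the middle of the
first leaf, with time `1` left there. -/
noncomputable def spent {n : ℕ} (T : MTree n) (t : ℝ) (b : ℕ) : ℝ :=
  max 0 (min (t + 1 - ∑ j ∈ Finset.Ico 1 b, 2 * T.spine j) (2 * T.spine b))

lemma spine_nonneg {n : ℕ} (T : MTree n) (b : ℕ) : 0 ≤ T.spine b := by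
  unfold spine
  split_ifs
  · exact zero_le_one
  · exact T.nonneg _ _

lemma spine_le_one {n : ℕ} (T : MTree n) (b : ℕ) : T.spine b ≤ 1 := by
  unfold spine
  split_ifs
  · exact le_rfl
  · exact T.le_one _ _

lemma spent_le {n : ℕ} (T : MTree n) (t : ℝ) (b : ℕ) : T.spent t b ≤ 2 * T.spine b :=
  max_le (by have := T.spine_nonneg b; positivity) (min_le_right _ _)

lemma spent_eq_of_lt {n : ℕ} (T : MTree n) (t : ℝ) {b c : ℕ} (h1 : 1 ≤ b) (hbc : b < c)
    (h : T.spent t c ≠ 0) : T.spent t b = 2 * T.spine b := by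
  have h0 : 0 < t + 1 - ∑ j ∈ Finset.Ico 1 c, 2 * T.spine j := by
    by_contra hc
    push Not at hc
    exact h (max_eq_left ((min_le_left _ _).trans hc))
  have h2 : ∑ j ∈ Finset.Ico 1 (b + 1), 2 * T.spine j ≤ ∑ j ∈ Finset.Ico 1 c, 2 * T.spine j := by
    refine Finset.sum_le_sum_of_subset_of_nonneg (Finset.Ico_subset_Ico le_rfl hbc) ?_
    intro j _ _
    have := T.spine_nonneg j
    positivity
  rw [Finset.sum_Ico_succ_top h1] at h2
  unfold spent
  rw [min_eq_right (by linarith), max_eq_right (by have := T.spine_nonneg b; positivity)]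

open Classical in
/-- The sliding path `σ(T)` in `K_{n+1}`, for a tree `T` with `n ≥ 2` leaves. Let the root edge of
`T` become the last leaf `n + 1`, and let a new root edge slide along `T` from the first leaf
(where, at time `0`, it is at distance `1` from the vertex next to the first leaf) to the former
root (where, at time `l(T)`, it is at distance `1` from the former root vertex). While it sits on an
internal edge of length `u`, that edge is divided in two, of lengths `(s, u)` for `0 ≤ s ≤ u` and
then `(u, 2u - s)` for `u ≤ s ≤ 2u`.

An edge `{1, …, b}` of `T` that has been passed stays the same; an edge `{1, …, b}` still ahead is
traversed in the opposite direction and becomes `{b + 1, …, n + 1}`; the other edges of `T` remain.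
For `T = T₁ ∘_i^r T₂` this gives `σ(T) = σ(T₁) ∘_i^r T₂` if `i > 1`. For `i = 1` it gives the
juxtaposition of `σ(T₂)`, restricted to `[0, l(T₂) + r - 1]` and with the tree `T₁` (its first leaf
now being its root) grafted to the last leaf with length `r`, and of `σ(T₁) ∘_1^r T₂`, restricted
to `[1 - r, l(T₁)]`. -/
noncomputable def slide {n : ℕ} (T : MTree n) (t : ℝ) : MTree (n + 1) where
  len a b :=
    if ¬ IsCluster (n + 1) a b then 0
    else if a = 1 then min (T.spine b) (T.spent t b)
    else if b = n + 1 then min (T.spine (a - 1)) (2 * T.spine (a - 1) - T.spent t (a - 1))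
    else T.len a b
  nonneg a b := by
    split_ifs
    all_goals first
      | exact le_rfl
      | exact T.nonneg _ _
      | exact le_min (T.spine_nonneg _) (le_max_left _ _)
      | exact le_min (T.spine_nonneg _) (sub_nonneg.2 (T.spent_le t (a - 1)))
  le_one a b := by
    split_ifs
    all_goals first
      | exact zero_le_one
      | exact T.le_one _ _
      | exact (min_le_left _ _).trans (T.spine_le_one _)
  isCluster a b h := by
    by_contra h'
    simp [h'] at h
  laminar := by
    have A : ∀ b, min (T.spine b) (T.spent t b) ≠ 0 →
        (b = 1 ∨ b = n ∨ T.len 1 b ≠ 0) ∧ T.spent t b ≠ 0 := by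
      intro b h
      constructor
      · by_contra hc
        push Not at hc
        have : T.spine b = 0 := by simp [spine, hc.1, hc.2.1, hc.2.2]
        apply h
        rw [this]
        exact min_eq_left (le_max_left _ _)
      · intro hc
        apply h
        rw [hc]
        exact min_eq_right (T.spine_nonneg _)
    have B : ∀ b, min (T.spine b) (2 * T.spine b - T.spent t b) ≠ 0 →
        (b = 1 ∨ b = n ∨ T.len 1 b ≠ 0) ∧ T.spent t b ≠ 2 * T.spine b := by
      intro b h
      constructor
      · by_contra hc
        push Not at hc
        have : T.spine b = 0 := by simp [spine, hc.1, hc.2.1, hc.2.2]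
        apply h
        have h2 := T.spent_le t b
        rw [this] at h2 ⊢
        exact min_eq_left (by linarith)
      · intro hc
        apply h
        rw [hc, sub_self]
        exact min_eq_right (T.spine_nonneg _)
    have AB : ∀ b c, 1 ≤ c → T.spent t b ≠ 0 → T.spent t c ≠ 2 * T.spine c → b ≤ c := by
      intro b c hc h h'
      by_contra hlt
      exact h' (T.spent_eq_of_lt t hc (by omega) h)
    have hT := T.laminar
    have hT' := T.isCluster
    intro a b c d h h'
    by_cases h1 : IsCluster (n + 1) a b
    · by_cases h2 : IsCluster (n + 1) c d
      · simp only [h1, h2, not_true_eq_false, if_false] at h h'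
        unfold IsCluster Compat at *
        split_ifs at h h' with q1 q2 q3 q4 q5 q6 q7
        · omega
        · obtain ⟨_, h⟩ := A _ h
          obtain ⟨_, h'⟩ := B _ h'
          have := AB _ _ (by omega) h h'
          omega
        · have e2 := hT' _ _ h'
          obtain ⟨h | h | h, -⟩ := A _ h
          · omega
          · omega
          · have := hT _ _ _ _ h h'
            omega
        · obtain ⟨_, h⟩ := B _ h
          obtain ⟨_, h'⟩ := A _ h'
          have := AB _ _ (by omega) h' h
          omega
        · omega
        · have e2 := hT' _ _ h'
          obtain ⟨h | h | h, -⟩ := B _ h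
          · omega
          · omega
          · have := hT _ _ _ _ h h'
            omega
        · have e2 := hT' _ _ h
          obtain ⟨h' | h' | h', -⟩ := A _ h'
          · omega
          · omega
          · have := hT _ _ _ _ h h'
            omega
        · have e2 := hT' _ _ h
          obtain ⟨h' | h' | h', -⟩ := B _ h'
          · omega
          · omega
          · have := hT _ _ _ _ h h'
            omega
        · exact hT _ _ _ _ h h'
      · simp [h2] at h'
    · simp [h1] at h

/-- The path `λ(T)` in `K_n`, for a tree `T` with `n ≥ 2` leaves: the path `σ(T)` with the last
leaf `n + 1` erased. It ends in `T`. -/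
noncomputable def slideErase {n : ℕ} (T : MTree n) (t : ℝ) : MTree n := degen (n + 1) (T.slide t)

/-- The length of `λ(T)`. It is `l(T) - 1` if the root vertex has more than two inputs. If the root
vertex has two inputs, coming from edges of lengths `u` and `v` (leaves count as edges of length
`1`), it is `l(T) - 1 - min u v`; the two edges are then `{1, …, b}` and `{b + 1, …, n}` for some
`b`, so that at most one summand below is nonzero. From this time on `λ(T)` is constant. -/
noncomputable def slideEraseLength {n : ℕ} (T : MTree n) : ℝ :=
  T.slideLength - 1 -
    ∑ b ∈ Finset.Ico 1 n, min (T.spine b) (if b + 1 = n then 1 else T.len (b + 1) n)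

end MTree

/-! ## Compactly generated topologies -/

/-- The space `A` with the compactly generated topology: the finest topology for which all maps
from compact Hausdorff spaces to `A`, continuous in the original sense, are continuous. All
products of spaces are given this topology. -/
structure Kify (A : Type u) : Type u where
  of ::
  val : A

namespace Kify

variable {A B : Type u} [TopologicalSpace A] [TopologicalSpace B]

instance : TopologicalSpace (Kify A) :=
  TopologicalSpace.coinduced Kify.of (TopologicalSpace.compactlyGenerated.{u} A)

lemma continuous_from {C : Type*} [TopologicalSpace C] {f : Kify A → C}
    (h : ∀ (S : CompHaus.{u}) (g : C(S, A)), Continuous fun s => f (of (g s))) : Continuous f :=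
  continuous_coinduced_dom.2 (continuous_from_compactlyGenerated _ h)

lemma continuous_val : Continuous (val : Kify A → A) := continuous_from fun _ g => g.2

lemma continuous_of {C : Type*} [TopologicalSpace C] [UCompactlyGeneratedSpace.{u} C] {f : C → A}
    (hf : Continuous f) : Continuous fun c => of (f c) := by
  refine continuous_from_uCompactlyGeneratedSpace.{u} _ fun S g => ?_
  let F : (Σ (i : (S : CompHaus.{u}) × C(S, A)), i.fst) → Kify A := fun p => of (p.1.2 p.2)
  have hF : Continuous F := @Continuous.comp _ _ _ _ (TopologicalSpace.compactlyGenerated.{u} A)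
    _ _ _ continuous_coinduced_rng continuous_coinduced_rng
  exact (continuous_sigma_iff.1 hF) ⟨S, ⟨fun s => f (g s), hf.comp g.2⟩⟩

lemma continuous_map {f : A → B} (hf : Continuous f) :
    Continuous fun a : Kify A => of (f a.val) := by
  refine continuous_from fun S g => ?_
  let F : (Σ (i : (S : CompHaus.{u}) × C(S, B)), i.fst) → Kify B := fun p => of (p.1.2 p.2)
  have hF : Continuous F := @Continuous.comp _ _ _ _ (TopologicalSpace.compactlyGenerated.{u} B)
    _ _ _ continuous_coinduced_rng continuous_coinduced_rng
  exact (continuous_sigma_iff.1 hF) ⟨S, ⟨fun s => f (g s), hf.comp g.2⟩⟩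

end Kify

/-! ## `A_∞`-spaces, `A_∞`-maps and `A_∞`-actions -/

/-- The tuple `(x₁, …, x_a, v, z₁, …, z_b)`. -/
abbrev insertAt {X : Type u} {a b : ℕ} (x : Fin a → X) (v : X) (z : Fin b → X) :
    Fin (a + 1 + b) → X :=
  Fin.append (Fin.append x fun _ : Fin 1 => v) z

/-- An `A_∞`-structure (with strict unit) on `X`: an algebra structure over the operad of metric
trees. The unit is `M 0 δ_0`. -/
structure AInftySpace (X : Type u) [TopologicalSpace X] where
  M : ∀ n : ℕ, MTree n → (Fin n → X) → X
  continuous_M : ∀ n, Continuous fun q : Kify (MTree n × (Fin n → X)) => M n q.val.1 q.val.2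
  M_one : ∀ x : X, M 1 (MTree.corolla 1) (fun _ => x) = x
  M_graft : ∀ (a m b : ℕ) (_ : 1 ≤ m) (ρ : MTree (a + 1 + b)) (τ : MTree m)
    (x : Fin a → X) (y : Fin m → X) (z : Fin b → X),
    M (a + m + b) (ρ.graft 1 (a + 1) τ) (Fin.append (Fin.append x y) z) =
      M (a + 1 + b) ρ (insertAt x (M m τ y) z)
  M_degen : ∀ (a b : ℕ) (ρ : MTree (a + 1 + b)) (x : Fin a → X) (z : Fin b → X),
    M (a + b) (ρ.degen (a + 1)) (Fin.append x z) =
      M (a + 1 + b) ρ (insertAt x (M 0 (MTree.corolla 0) Fin.elim0) z)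

/-- A left `A_∞`-action of `X` on `P`, given by its structure maps
`N_{k+1} : K_{k+1} × X^k × P → P`. -/
structure AInftyAction {X : Type u} [TopologicalSpace X] (S : AInftySpace X)
    (P : Type u) [TopologicalSpace P] where
  N : ∀ k : ℕ, MTree (k + 1) → (Fin k → X) → P → P
  continuous_N : ∀ k, Continuous fun q : Kify (MTree (k + 1) × (Fin k → X) × P) => N k q.val.1 q.val.2.1 q.val.2.2
  N_one : ∀ p : P, N 0 (MTree.corolla 1) Fin.elim0 p = p
  N_graft : ∀ (a m b : ℕ) (_ : 1 ≤ m) (ρ : MTree (a + 1 + b + 1)) (τ : MTree m)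
    (x : Fin a → X) (y : Fin m → X) (z : Fin b → X) (p : P),
    N (a + m + b) (ρ.graft 1 (a + 1) τ) (Fin.append (Fin.append x y) z) p =
      N (a + 1 + b) ρ (insertAt x (S.M m τ y) z) p
  N_degen : ∀ (a b : ℕ) (ρ : MTree (a + 1 + b + 1)) (x : Fin a → X) (z : Fin b → X) (p : P),
    N (a + b) (ρ.degen (a + 1)) (Fin.append x z) p =
      N (a + 1 + b) ρ (insertAt x (S.M 0 (MTree.corolla 0) Fin.elim0) z) p
  N_graft_last : ∀ (n m : ℕ) (ρ : MTree (n + 1)) (τ : MTree (m + 1))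
    (x : Fin n → X) (y : Fin m → X) (p : P),
    N (n + m) (ρ.graft 1 (n + 1) τ) (Fin.append x y) p = N n ρ x (N m τ y p)

/-- The family `f_n : K_{n+1} × X^n → Y`, `n ≥ 1`, is an `A_∞`-map from the `A_∞`-space `X` to
the topological monoid `Y`, with underlying map `x ↦ f_1(δ_2; x)`. (The value of `f` at `n = 0` is
irrelevant.) -/
structure IsAInftyMap {X : Type u} [TopologicalSpace X] (S : AInftySpace X)
    {Y : Type u} [TopologicalSpace Y] [Monoid Y]
    (f : ∀ n : ℕ, MTree (n + 1) → (Fin n → X) → Y) : Prop where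
  continuous : ∀ n, 1 ≤ n → Continuous fun q : Kify (MTree (n + 1) × (Fin n → X)) => f n q.val.1 q.val.2
  graft : ∀ (a m b : ℕ) (_ : 2 ≤ m) (ρ : MTree (a + 1 + b + 1)) (τ : MTree m)
    (x : Fin a → X) (y : Fin m → X) (z : Fin b → X),
    f (a + m + b) (ρ.graft 1 (a + 2) τ) (Fin.append (Fin.append x y) z) =
      f (a + 1 + b) ρ (insertAt x (S.M m τ y) z)
  graft_first : ∀ (m n : ℕ) (_ : 1 ≤ m) (_ : 1 ≤ n) (ρ : MTree (n + 1)) (τ : MTree (m + 1))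
    (x : Fin m → X) (y : Fin n → X),
    f (m + n) (ρ.graft 1 1 τ) (Fin.append x y) = f m τ x * f n ρ y

/-- The family `F_{n+1} : K_{n+2} × X^n × P → Q`, `n ≥ 0`, exhibits the map `φ = F_1 : P → Q` as
`A_∞`-equivariant with respect to the `A_∞`-map `f` from `X` to a monoid `Y` that acts on `Q`. -/
structure IsAInftyEquivariance {X : Type u} [TopologicalSpace X] {S : AInftySpace X}
    {P : Type u} [TopologicalSpace P] (A : AInftyAction S P)
    {Y : Type u} [Monoid Y] {Q : Type u} [TopologicalSpace Q] [MulAction Y Q]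
    (f : ∀ n : ℕ, MTree (n + 1) → (Fin n → X) → Y) (φ : P → Q)
    (F : ∀ n : ℕ, MTree (n + 2) → (Fin n → X) → P → Q) : Prop where
  continuous : ∀ n, Continuous fun q : Kify (MTree (n + 2) × (Fin n → X) × P) => F n q.val.1 q.val.2.1 q.val.2.2
  one : ∀ p : P, F 0 (MTree.corolla 2) Fin.elim0 p = φ p
  graft : ∀ (a m b : ℕ) (_ : 2 ≤ m) (τ : MTree (a + 1 + b + 2)) (ρ : MTree m)
    (x : Fin a → X) (y : Fin m → X) (z : Fin b → X) (p : P),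
    F (a + m + b) (τ.graft 1 (a + 2) ρ) (Fin.append (Fin.append x y) z) p =
      F (a + 1 + b) τ (insertAt x (S.M m ρ y) z) p
  graft_last : ∀ (n m : ℕ) (_ : 1 ≤ m) (τ : MTree (n + 2)) (ρ : MTree (m + 1))
    (x : Fin n → X) (y : Fin m → X) (p : P),
    F (n + m) (τ.graft 1 (n + 2) ρ) (Fin.append x y) p = F n τ x (A.N m ρ y p)
  graft_first : ∀ (m n : ℕ) (_ : 1 ≤ m) (τ : MTree (n + 2)) (ρ : MTree (m + 1))
    (x : Fin m → X) (y : Fin n → X) (p : P),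
    F (m + n) (τ.graft 1 1 ρ) (Fin.append x y) p = f m ρ x • F n τ y p

/-! ## Moore paths and Moore loops -/

/-- A Moore path in `B`. -/
@[ext]
structure MoorePath (B : Type u) [TopologicalSpace B] where
  path : C(ℝ≥0, B)
  length : ℝ≥0
  stationary : ∀ t, length ≤ t → path t = path length

section Moore

variable {B : Type u} [TopologicalSpace B]

/-- Compactly generated topology of the subspace of (mapping space) × (lengths). -/
instance : TopologicalSpace (MoorePath B) :=
  @TopologicalSpace.compactlyGenerated.{u} (MoorePath B)
    (TopologicalSpace.induced (fun γ => (γ.path, γ.length)) inferInstance)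

/-- Juxtaposition of Moore paths. -/
noncomputable def MoorePath.concat (γ δ : MoorePath B) (h : γ.path γ.length = δ.path 0) :
    MoorePath B where
  path :=
    { toFun := fun t => if t ≤ γ.length then γ.path t else δ.path (t - γ.length)
      continuous_toFun := by
        refine Continuous.if_le γ.path.continuous
          (δ.path.continuous.comp (continuous_id.sub continuous_const)) continuous_id
          continuous_const ?_
        intro t ht
        have ht : t = γ.length := ht
        simp [ht, h] }
  length := γ.length + δ.length
  stationary t ht := by
    have h1 : δ.length ≤ t - γ.length := le_tsub_of_add_le_left ht
    have key : ∀ s : ℝ≥0, γ.length ≤ s →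
        (if s ≤ γ.length then γ.path s else δ.path (s - γ.length)) = δ.path (s - γ.length) := by
      intro s hs
      split_ifs with h2
      · have : s = γ.length := le_antisymm h2 hs
        simp [this, h]
      · rfl
    simp only [ContinuousMap.coe_mk]
    rw [key _ (le_trans (by simp) ht), key _ (by simp), add_tsub_cancel_left,
      δ.stationary _ h1]

/-- The relative Moore loops `Ω_M(B, A)`: Moore paths from the base point `b` to a point of `A`. -/
@[ext]
structure RelMooreLoop (B : Type u) [TopologicalSpace B] (b : B) (A : Set B) extends
    MoorePath B where
  start : path 0 = b
  finish : path length ∈ A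

instance (b : B) (A : Set B) : TopologicalSpace (RelMooreLoop B b A) :=
  @TopologicalSpace.compactlyGenerated.{u} (RelMooreLoop B b A)
    (TopologicalSpace.induced RelMooreLoop.toMoorePath inferInstance)

/-- The Moore loops `Ω_M(B)` at the base point `b`. -/
abbrev MooreLoop (B : Type u) [TopologicalSpace B] (b : B) : Type u := RelMooreLoop B b {b}

variable {b : B} {A : Set B}

/-- Juxtaposition of a loop and a relative loop. -/
noncomputable def RelMooreLoop.comp (γ : MooreLoop B b) (δ : RelMooreLoop B b A) :
    RelMooreLoop B b A where
  toMoorePath := γ.toMoorePath.concat δ.toMoorePath (γ.finish.trans δ.start.symm)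
  start := by simp [MoorePath.concat, γ.start]
  finish := by
    have := δ.finish
    have h1 : γ.path γ.length = b := γ.finish
    simp only [MoorePath.concat, ContinuousMap.coe_mk]
    split_ifs with h
    · have h0 : δ.length = 0 := by simpa using h
      rw [h0, add_zero, h1, ← δ.start]
      rwa [h0] at this
    · simpa using this

/-- The constant loop of length `0`. -/
def MooreLoop.one (b : B) : MooreLoop B b where
  path := ContinuousMap.const _ b
  length := 0
  stationary _ _ := rfl
  start := rfl
  finish := rfl

lemma RelMooreLoop.one_comp (δ : RelMooreLoop B b A) : (MooreLoop.one b).comp δ = δ := by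
  refine RelMooreLoop.ext (ContinuousMap.ext fun t => ?_) ?_
  · simp only [RelMooreLoop.comp, MoorePath.concat, MooreLoop.one, ContinuousMap.coe_mk]
    by_cases h : t = 0
    · simp [h, δ.start]
    · simp [h]
  · simp [RelMooreLoop.comp, MoorePath.concat, MooreLoop.one]

lemma RelMooreLoop.comp_one (γ : MooreLoop B b) : γ.comp (MooreLoop.one b) = γ := by
  refine RelMooreLoop.ext (ContinuousMap.ext fun t => ?_) ?_
  · simp only [RelMooreLoop.comp, MoorePath.concat, MooreLoop.one, ContinuousMap.coe_mk]
    split_ifs with h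
    · rfl
    · rw [γ.stationary t (le_of_not_ge h)]
      exact γ.finish.symm
  · simp [RelMooreLoop.comp, MoorePath.concat, MooreLoop.one]

lemma RelMooreLoop.comp_assoc (γ γ' : MooreLoop B b) (δ : RelMooreLoop B b A) :
    RelMooreLoop.comp (RelMooreLoop.comp γ γ') δ = RelMooreLoop.comp γ (RelMooreLoop.comp γ' δ) := by
  refine RelMooreLoop.ext (ContinuousMap.ext fun t => ?_) ?_
  · simp only [RelMooreLoop.comp, MoorePath.concat, ContinuousMap.coe_mk]
    by_cases h1 : t ≤ γ.length
    · have h2 : t ≤ γ.length + γ'.length := h1.trans (by simp)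
      simp [h1, h2]
    · by_cases h2 : t ≤ γ.length + γ'.length
      · have h3 : t - γ.length ≤ γ'.length := tsub_le_iff_left.2 h2
        simp [h1, h2, h3]
      · have h3 : ¬ t - γ.length ≤ γ'.length := fun h => h2 (tsub_le_iff_left.1 h)
        simp [h1, h2, h3, tsub_tsub]
  · simp [RelMooreLoop.comp, MoorePath.concat, add_assoc]

/-- The monoid structure of the Moore loops given by juxtaposition. -/
noncomputable instance : Monoid (MooreLoop B b) where
  mul γ δ := RelMooreLoop.comp γ δ
  one := MooreLoop.one b
  mul_assoc γ γ' δ := RelMooreLoop.comp_assoc γ γ' δ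
  one_mul δ := RelMooreLoop.one_comp δ
  mul_one γ := RelMooreLoop.comp_one γ

/-- The action of the Moore loops on the relative Moore loops given by juxtaposition. -/
noncomputable instance : MulAction (MooreLoop B b) (RelMooreLoop B b A) where
  smul γ δ := RelMooreLoop.comp γ δ
  one_smul δ := RelMooreLoop.one_comp δ
  mul_smul γ γ' δ := RelMooreLoop.comp_assoc γ γ' δ

/-- The map of Moore loops induced by a based map. -/
def MooreLoop.map {B' : Type u} [TopologicalSpace B'] (g : C(B, B')) (γ : MooreLoop B b) :
    MooreLoop B' (g b) where
  path := g.comp γ.path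
  length := γ.length
  stationary t ht := congrArg g (γ.stationary t ht)
  start := congrArg g γ.start
  finish := congrArg g γ.finish

end Moore

/-! ## The two-sided bar construction -/

section Bar

variable {Q X P : Type u} [TopologicalSpace Q] [TopologicalSpace X] [TopologicalSpace P]

/-- The disjoint union of the spaces `K_{n+2} × Q × X^n × P`. -/
abbrev BarPre (Q X P : Type u) : Type u :=
  Σ n : ℕ, Kify (MTree (n + 2) × Q × (Fin n → X) × P)

/-- The identifications of the two-sided bar construction, for structure maps
`R_{k+1} : K_{k+1} × Q × X^k → Q`, `M_n : K_n × X^n → X` and `N_{k+1} : K_{k+1} × X^k × P → P`. -/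
inductive BarRel (R : ∀ k : ℕ, MTree (k + 1) → Q → (Fin k → X) → Q)
    (M : ∀ n : ℕ, MTree n → (Fin n → X) → X)
    (N : ∀ k : ℕ, MTree (k + 1) → (Fin k → X) → P → P) : BarPre Q X P → BarPre Q X P → Prop
  | left (m n : ℕ) (ρ : MTree (n + 2)) (τ : MTree (m + 1)) (q : Q) (x : Fin m → X)
      (y : Fin n → X) (p : P) :
      BarRel R M N ⟨m + n, .of (ρ.graft 1 1 τ, q, Fin.append x y, p)⟩ ⟨n, .of (ρ, R m τ q x, y, p)⟩
  | middle (a m b : ℕ) (hm : 1 ≤ m) (ρ : MTree (a + 1 + b + 2)) (τ : MTree m) (q : Q)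
      (x : Fin a → X) (y : Fin m → X) (z : Fin b → X) (p : P) :
      BarRel R M N
        ⟨a + m + b, .of (ρ.graft 1 (a + 2) τ, q, Fin.append (Fin.append x y) z, p)⟩
        ⟨a + 1 + b, .of (ρ, q, insertAt x (M m τ y) z, p)⟩
  | right (n m : ℕ) (ρ : MTree (n + 2)) (τ : MTree (m + 1)) (q : Q) (x : Fin n → X)
      (y : Fin m → X) (p : P) :
      BarRel R M N ⟨n + m, .of (ρ.graft 1 (n + 2) τ, q, Fin.append x y, p)⟩ ⟨n, .of (ρ, q, x, N m τ y p)⟩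

/-- The two-sided bar construction `B(Q, X, P)`, with the quotient topology. -/
def Bar (R : ∀ k : ℕ, MTree (k + 1) → Q → (Fin k → X) → Q)
    (M : ∀ n : ℕ, MTree n → (Fin n → X) → X)
    (N : ∀ k : ℕ, MTree (k + 1) → (Fin k → X) → P → P) : Type u :=
  Quot (BarRel R M N)

variable {R : ∀ k : ℕ, MTree (k + 1) → Q → (Fin k → X) → Q}
  {M : ∀ n : ℕ, MTree n → (Fin n → X) → X}
  {N : ∀ k : ℕ, MTree (k + 1) → (Fin k → X) → P → P}

instance : TopologicalSpace (Bar R M N) := instTopologicalSpaceQuot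

/-- The class `[T; q, x_1, …, x_n, p]`. -/
def Bar.mk {n : ℕ} (T : MTree (n + 2)) (q : Q) (x : Fin n → X) (p : P) : Bar R M N :=
  Quot.mk _ ⟨n, .of (T, q, x, p)⟩

variable {P' : Type u} [TopologicalSpace P'] {N' : ∀ k : ℕ, MTree (k + 1) → (Fin k → X) → P' → P'}

/-- The map `B(Q, X, P) → B(Q, X, P')` induced by a map `P → P'` compatible with the structure
maps. -/
def Bar.map (g : P → P') (hg : ∀ k T x p, g (N k T x p) = N' k T x (g p)) :
    Bar R M N → Bar R M N' :=
  Quot.map (fun s => ⟨s.1, .of (s.2.val.1, s.2.val.2.1, s.2.val.2.2.1, g s.2.val.2.2.2)⟩) (by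
    rintro _ _ (⟨m, n, ρ, τ, q, x, y, p⟩ | ⟨a, m, b, hm, ρ, τ, q, x, y, z, p⟩ |
      ⟨n, m, ρ, τ, q, x, y, p⟩)
    · exact BarRel.left m n ρ τ q x y (g p)
    · exact BarRel.middle a m b hm ρ τ q x y z (g p)
    · simp only [hg]
      exact BarRel.right n m ρ τ q x y (g p))

lemma Bar.continuous_map (g : P → P') (hg : ∀ k T x p, g (N k T x p) = N' k T x (g p))
    (hc : Continuous g) : Continuous (Bar.map (R := R) (M := M) g hg) := by
  refine continuous_quot_lift _ (continuous_quot_mk.comp (continuous_sigma fun n => ?_))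
  refine continuous_sigmaMk.comp (Kify.continuous_map (f := fun s : MTree (n + 2) × Q ×
    (Fin n → X) × P => (s.1, s.2.1, s.2.2.1, g s.2.2.2)) (by fun_prop))

/-- The class `[T; q, x, p]` depends continuously on `p`. -/
lemma Bar.continuous_mk_comp {C : Type*} [TopologicalSpace C] [UCompactlyGeneratedSpace.{u} C]
    {n : ℕ} (T : MTree (n + 2)) (q : Q) (x : Fin n → X) {h : C → P} (hc : Continuous h) :
    Continuous fun c => (Bar.mk T q x (h c) : Bar R M N) :=
  continuous_quot_mk.comp (continuous_sigmaMk.comp (Kify.continuous_of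
    (f := fun c => (T, q, x, h c)) (by fun_prop)))

end Bar

/-- The trivial right action on the one-point space. -/
def trivialRight (X : Type u) :
    ∀ k : ℕ, MTree (k + 1) → PUnit.{u + 1} → (Fin k → X) → PUnit.{u + 1} := fun _ _ _ _ => ⟨⟩

/-- The trivial left action on the one-point space. -/
def trivialLeft (X : Type u) :
    ∀ k : ℕ, MTree (k + 1) → (Fin k → X) → PUnit.{u + 1} → PUnit.{u + 1} := fun _ _ _ _ => ⟨⟩

section Orbit

variable {X : Type u} [TopologicalSpace X]

/-- The homotopy orbit space `P // X = B(*, X, P)` of an action with structure maps `N`. -/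
abbrev HomotopyOrbit (S : AInftySpace X) {P : Type u} [TopologicalSpace P]
    (N : ∀ k : ℕ, MTree (k + 1) → (Fin k → X) → P → P) : Type u :=
  Bar (trivialRight X) S.M N

/-- The classifying space `BX = B(*, X, *)`. -/
abbrev ClassifyingSpace (S : AInftySpace X) : Type u := HomotopyOrbit S (trivialLeft X)

/-- The base point `[δ_2; *, *]` of `BX`. -/
def ClassifyingSpace.base (S : AInftySpace X) : ClassifyingSpace S :=
  Bar.mk (n := 0) (MTree.corolla 2) ⟨⟩ Fin.elim0 ⟨⟩

end Orbit

/-! ## The cone -/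

section Cone

variable {P : Type u} [TopologicalSpace P]

/-- The unreduced cone `CP`: the quotient of `P × [0, 1]` in which `P × {0}` is collapsed to the
tip. -/
def Cone (P : Type u) [TopologicalSpace P] : Type u :=
  Quot fun a b : Kify (P × I) => a.val.2 = 0 ∧ b.val.2 = 0

instance : TopologicalSpace (Cone P) := instTopologicalSpaceQuot

/-- The point `[p, t]` of the cone. -/
def Cone.mk (p : P) (t : I) : Cone P := Quot.mk _ (.of (p, t))

/-- The tip of the cone. -/
noncomputable def Cone.tip (P : Type u) [TopologicalSpace P] [Nonempty P] : Cone P :=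
  Cone.mk (Classical.arbitrary P) 0

lemma Cone.mk_zero [Nonempty P] (p : P) : Cone.mk p 0 = Cone.tip P := Quot.sound ⟨rfl, rfl⟩

variable {X : Type u} [TopologicalSpace X] {S : AInftySpace X}

/-- The extension of an `A_∞`-action on `P` to the cone, `(T; x, [p, t]) ↦ [N(T; x, p), t]`. -/
def AInftyAction.cone (A : AInftyAction S P) :
    ∀ k : ℕ, MTree (k + 1) → (Fin k → X) → Cone P → Cone P :=
  fun k T x => Quot.map (fun c => .of (A.N k T x c.val.1, c.val.2)) fun _ _ h => h

/-- The subset `P // X` of `CP // X`: the image of the map induced by the inclusion `p ↦ [p, 1]`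
of the base of the cone. -/
def AInftyAction.baseOrbit (A : AInftyAction S P) : Set (HomotopyOrbit S A.cone) :=
  Set.range (Bar.map (N := A.N) (fun p : P => Cone.mk p 1) fun _ _ _ _ => rfl)

/-- The map `BX → CP // X` induced by the inclusion of the tip of the cone. -/
noncomputable def AInftyAction.tipMap [Nonempty P] (A : AInftyAction S P) :
    C(ClassifyingSpace S, HomotopyOrbit S A.cone) where
  toFun := Bar.map (fun _ => Cone.tip P) fun _ _ _ _ => (Cone.mk_zero _).symm
  continuous_toFun := Bar.continuous_map _ _ continuous_const

/-- The space `Ω_M(CP // X)`, based at the image of the base point of `BX`. -/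
abbrev AInftyAction.OrbitLoop [Nonempty P] (A : AInftyAction S P) : Type u :=
  MooreLoop (HomotopyOrbit S A.cone) (A.tipMap (ClassifyingSpace.base S))

/-- The space `Ω_M(CP // X, P // X)`. -/
abbrev AInftyAction.OrbitRelLoop [Nonempty P] (A : AInftyAction S P) : Type u :=
  RelMooreLoop (HomotopyOrbit S A.cone) (A.tipMap (ClassifyingSpace.base S)) A.baseOrbit

lemma Cone.continuous_mk (p : P) : Continuous fun t : ℝ≥0 =>
    Cone.mk p (Set.projIcc 0 1 zero_le_one (t : ℝ)) :=
  continuous_quot_mk.comp (Kify.continuous_of (f := fun t : ℝ≥0 =>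
    (p, Set.projIcc (0 : ℝ) 1 zero_le_one (t : ℝ)))
    (continuous_const.prodMk (continuous_projIcc.comp NNReal.continuous_coe)))

/-- The relative loop `γ_p(t) = [δ_2; *, [p, t]]` of length `1`. -/
noncomputable def AInftyAction.gamma [Nonempty P] (A : AInftyAction S P) (p : P) :
    A.OrbitRelLoop where
  path := ⟨fun t => Bar.mk (n := 0) (MTree.corolla 2) ⟨⟩ Fin.elim0
      (Cone.mk p (Set.projIcc 0 1 zero_le_one (t : ℝ))),
    Bar.continuous_mk_comp _ _ _ (Cone.continuous_mk p)⟩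
  length := 1
  stationary t ht := by
    have h1 : Set.projIcc (0 : ℝ) 1 zero_le_one (t : ℝ) = 1 :=
      Set.projIcc_of_right_le _ (by exact_mod_cast ht)
    have h2 : Set.projIcc (0 : ℝ) 1 zero_le_one ((1 : ℝ≥0) : ℝ) = 1 :=
      Set.projIcc_of_right_le _ (by simp)
    simp only [ContinuousMap.coe_mk, h1, h2]
  start := by
    have h0 : Set.projIcc (0 : ℝ) 1 zero_le_one ((0 : ℝ≥0) : ℝ) = 0 :=
      Set.projIcc_of_le_left _ (by simp)
    simp only [ContinuousMap.coe_mk, h0, Cone.mk_zero]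
    rfl
  finish := by
    have h2 : Set.projIcc (0 : ℝ) 1 zero_le_one ((1 : ℝ≥0) : ℝ) = 1 :=
      Set.projIcc_of_right_le _ (by simp)
    simp only [ContinuousMap.coe_mk, h2]
    exact ⟨Bar.mk (n := 0) (MTree.corolla 2) ⟨⟩ Fin.elim0 p, rfl⟩

end Cone

/-- The usual map `X → Ω_M(BX)`: `f x` is the loop of length `2` with
`f(x)(t) = [δ_2 ∘_2^{1-t} δ_2; *, x, *]` and `f(x)(1 + t) = [δ_2 ∘_1^t δ_2; *, x, *]` for
`0 ≤ t ≤ 1`. -/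
def IsUsualMap {X : Type u} [TopologicalSpace X] (S : AInftySpace X)
    (f : X → MooreLoop (ClassifyingSpace S) (ClassifyingSpace.base S)) : Prop :=
  ∀ x, (f x).length = 2 ∧ ∀ t : I,
    (f x).path ⟨t, t.2.1⟩ =
      Bar.mk (n := 1) ((MTree.corolla 2).graft (σ t) 2 (MTree.corolla 2)) ⟨⟩ (fun _ => x) ⟨⟩ ∧
    (f x).path (1 + ⟨t, t.2.1⟩) =
      Bar.mk (n := 1) ((MTree.corolla 2).graft t 1 (MTree.corolla 2)) ⟨⟩ (fun _ => x) ⟨⟩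

/-! All maps are explicit, so the theorem reduces to identities between metric trees. A tree is read
off from its edge lengths. On the sliding path an edge {1,…,b} of length u on which time s has been
spent contributes a part behind the new root of length min(u, s) and a part ahead, {b+1,…,n+1}, of
length min(u, 2u-s); all other edges stay put.

Grafting onto a leaf i > 1 leaves the spine from first leaf to root unchanged, so σ commutes with it
(`slide_graft`). Grafting S onto the first leaf of T with length 1 puts the spine of S before that
of T. Up to time l(S) the path is σ(S) with T, turned around, grafted to its last leaf
(`slide_graft_one_of_le`); afterwards it is σ(T) with S grafted to its first leaf
(`slide_graft_one_add`). In BX a tree grafted with length 1 to the first or last leaf acts on a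
point and is forgotten, so the loop is the juxtaposition of the loops of S and T. The same collapse
at the two ends makes these paths loops.

Erasing the last leaf commutes with length-1 grafting (`degen_graft`, `degen_graft_last`), so λ
satisfies the same identities. Its length behaves accordingly (`slideEraseLength_graft`,
`slideEraseLength_graft_one`), and λ(T) stays at T from that time on
(`slideErase_of_slideEraseLength_le`). Hence λ at the tip of the cone can be continued by running up
the cone with T fixed. During λ the cone point is the tip, which every action map fixes, so the
turned-around tree is again forgotten.

Lengths are built from minima, maxima and sums, so everything is continuous in tree and time.
Continuity into Moore path spaces is tested on compact Hausdorff spaces K, by currying maps from K ×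
[0,∞). -/

namespace MTree

variable {n m N : ℕ}

/-! ### Trees through their edge lengths -/

lemma len_eq_zero (T : MTree n) {a b : ℕ} (h : ¬ IsCluster n a b) : T.len a b = 0 :=
  by_contra fun h' => h (T.isCluster _ _ h')

/-- Off the clusters all lengths vanish, so each tree identity below becomes a case distinction on
the end points of a cluster. -/
lemma ext_of_isCluster {T T' : MTree n}
    (h : ∀ a b, IsCluster n a b → T.len a b = T'.len a b) : T = T' := by
  ext a b
  by_cases hab : IsCluster n a b
  · exact h a b hab
  · rw [T.len_eq_zero hab, T'.len_eq_zero hab]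

lemma len_graft (r : I) (i : ℕ) (T : MTree n) (S : MTree m) (hi : 1 ≤ i ∧ i ≤ n) (hm : 1 ≤ m)
    (hN : N + 1 = n + m) {a b : ℕ} (h : IsCluster N a b) :
    (T.graft r i S hi hm hN).len a b =
      if a = i ∧ b + 1 = i + m then (r : ℝ)
      else if i ≤ a ∧ b + 1 ≤ i + m then S.len (a + 1 - i) (b + 1 - i)
      else if b < i ∨ i + m ≤ a ∨ (a ≤ i ∧ i + m ≤ b + 1) then
        T.len (if a ≤ i then a else a + 1 - m) (if b < i then b else b + 1 - m)
      else 0 := by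
  simp only [graft, h, not_true_eq_false, if_false]

lemma len_slide (T : MTree n) (t : ℝ) {a b : ℕ} (h : IsCluster (n + 1) a b) :
    (T.slide t).len a b =
      if a = 1 then min (T.spine b) (T.spent t b)
      else if b = n + 1 then min (T.spine (a - 1)) (2 * T.spine (a - 1) - T.spent t (a - 1))
      else T.len a b := by
  simp only [slide, h, not_true_eq_false, if_false]

/-- Erasing the last leaf changes only the edges that contain the last remaining leaf. -/
lemma len_degen_last (T : MTree (n + 1)) {a b : ℕ} (h : IsCluster n a b) :
    (T.degen (n + 1) rfl).len a b =
      if b = n then max (T.len a n) (T.len a (n + 1)) else T.len a b := by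
  have h' := h
  unfold IsCluster at h'
  have h1 : a < n + 1 := by omega
  have h2 : b < n + 1 := by omega
  have h3 : a ≤ n + 1 := by omega
  simp only [degen, h, if_true, h1, h2, h3]
  split_ifs with h4 h5 h5
  · omega
  · exact max_self _
  · rw [h5]
  · omega

open Classical in
/-- The tree `T` with its first leaf as the new root, and its former root as the last leaf. -/
noncomputable def reroot (T : MTree n) : MTree n where
  -- The old leaf j becomes leaf j-1 and the old root becomes leaf n. An edge {1,…,a} separates the
  -- new root from the old leaves a+1,…,n and the old root, which are now the leaves a,…,n.
  len a b := if ¬ IsCluster n a b then 0 else if b = n then T.len 1 a else T.len (a + 1) (b + 1)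
  nonneg a b := by
    split_ifs
    all_goals first | exact le_rfl | exact T.nonneg _ _
  le_one a b := by
    split_ifs
    all_goals first | exact zero_le_one | exact T.le_one _ _
  isCluster a b h := by
    by_contra h'
    simp [h'] at h
  laminar a b c d h h' := by
    by_cases h1 : IsCluster n a b
    · by_cases h2 : IsCluster n c d
      · simp only [h1, h2, not_true_eq_false, if_false] at h h'
        have hT := T.laminar
        have hT' := T.isCluster
        unfold IsCluster Compat at *
        split_ifs at h h' <;>
        · have e1 := hT _ _ _ _ h h'
          have e2 := hT' _ _ h
          have e3 := hT' _ _ h'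
          omega
      · simp [h2] at h'
    · simp [h1] at h

lemma len_reroot (T : MTree n) {a b : ℕ} (h : IsCluster n a b) :
    T.reroot.len a b = if b = n then T.len 1 a else T.len (a + 1) (b + 1) := by
  simp only [reroot, h, not_true_eq_false, if_false]

/-! ### The spine -/

@[simp] lemma spine_one (T : MTree n) : T.spine 1 = 1 := by simp [spine]

@[simp] lemma spine_self (T : MTree n) : T.spine n = 1 := by simp [spine]

lemma spine_eq (T : MTree n) {b : ℕ} (h1 : b ≠ 1) (hn : b ≠ n) : T.spine b = T.len 1 b := by
  simp [spine, h1, hn]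

lemma spent_nonneg (T : MTree n) (t : ℝ) (b : ℕ) : 0 ≤ T.spent t b := le_max_left _ _

/-- The summand 1 in l(T) is the first leaf. The path starts one unit late on that leaf and ends one
unit into the root edge, so its total time equals the full time of all spine edges below the root
edge. -/
lemma slideLength_eq_sum (T : MTree n) (hn : 2 ≤ n) :
    T.slideLength = ∑ j ∈ Finset.Ico 1 n, 2 * T.spine j := by
  rw [slideLength, Finset.sum_eq_sum_Ico_succ_bot (show 1 < n by omega), spine_one,
    mul_add, Finset.mul_sum]
  congr 1
  refine Finset.sum_congr rfl fun j hj => ?_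
  rw [Finset.mem_Ico] at hj
  rw [spine_eq _ (by omega) (by omega)]

lemma sum_spine_mono (T : MTree n) {b c : ℕ} (h : b ≤ c) :
    ∑ j ∈ Finset.Ico 1 b, 2 * T.spine j ≤ ∑ j ∈ Finset.Ico 1 c, 2 * T.spine j := by
  refine Finset.sum_le_sum_of_subset_of_nonneg (Finset.Ico_subset_Ico le_rfl h) ?_
  intro j _ _
  have := T.spine_nonneg j
  positivity

lemma spent_eq_zero (T : MTree n) {t : ℝ} {b : ℕ}
    (h : t + 1 ≤ ∑ j ∈ Finset.Ico 1 b, 2 * T.spine j) : T.spent t b = 0 :=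
  max_eq_left ((min_le_left _ _).trans (by linarith))

lemma spent_eq_two_mul (T : MTree n) {t : ℝ} {b : ℕ} (hb : 1 ≤ b)
    (h : ∑ j ∈ Finset.Ico 1 (b + 1), 2 * T.spine j ≤ t + 1) : T.spent t b = 2 * T.spine b := by
  rw [Finset.sum_Ico_succ_top hb] at h
  have := T.spine_nonneg b
  unfold spent
  rw [min_eq_right (by linarith), max_eq_right (by positivity)]

lemma spent_eq_two_mul_of_slideLength_le (T : MTree n) {t : ℝ} {b : ℕ} (hb : 1 ≤ b) (hbn : b < n)
    (h : T.slideLength ≤ t) : T.spent t b = 2 * T.spine b := by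
  refine T.spent_eq_two_mul hb ((T.sum_spine_mono hbn).trans ?_)
  rw [← T.slideLength_eq_sum (by omega)]
  linarith

/-- The clock reads t + 1, so at time l(T) one unit is left for the former root edge. This is why
the edge {1,…,n} ends with length 1. -/
lemma one_le_spent_self (T : MTree n) {t : ℝ} (hn : 2 ≤ n) (h : T.slideLength ≤ t) :
    1 ≤ T.spent t n := by
  unfold spent
  rw [← T.slideLength_eq_sum hn, spine_self]
  exact le_max_of_le_right (le_min (by linarith) (by norm_num))

lemma two_le_slideLength (T : MTree n) : 2 ≤ T.slideLength := by
  have : 0 ≤ ∑ b ∈ Finset.Ico 2 n, T.len 1 b := Finset.sum_nonneg fun b _ => T.nonneg 1 b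
  unfold slideLength
  linarith

/-- The shift j + 1 - m is the renumbering of the leaves to the right of a grafted tree with m
leaves. -/
lemma sum_Ico_shift {f g : ℕ → ℝ} {k c : ℕ} (hm : m ≤ k + 1)
    (h : ∀ j, k ≤ j → j < c → g j = f (j + 1 - m)) (hc : k ≤ c) :
    ∑ j ∈ Finset.Ico k c, g j = ∑ j ∈ Finset.Ico (k + 1 - m) (c + 1 - m), f j := by
  induction c, hc using Nat.le_induction with
  | base => simp
  | succ c hc ih =>
    rw [Finset.sum_Ico_succ_top hc, ih fun j h1 h2 => h j h1 (by omega), h c hc c.lt_succ_self,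
      show c + 1 + 1 - m = c + 1 - m + 1 by omega,
      Finset.sum_Ico_succ_top (by omega)]

/-- Meant for sums over the spine of a tree with m leaves grafted onto leaf i > 1: no spine edge
ends at one of its leaves other than the last, so those indices contribute nothing. -/
lemma sum_Ico_gap {f g : ℕ → ℝ} {i c : ℕ} (hi : 1 ≤ i) (hm : 1 ≤ m) 
    (h1 : ∀ j, 1 ≤ j → j < i → g j = f j) (h2 : ∀ j, i ≤ j → j + 1 < i + m → g j = 0)
    (h3 : ∀ j, i + m ≤ j + 1 → j < c → g j = f (j + 1 - m)) (hc : i + m ≤ c + 1) :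
    ∑ j ∈ Finset.Ico 1 c, g j = ∑ j ∈ Finset.Ico 1 (c + 1 - m), f j := by
  rw [← Finset.sum_Ico_consecutive g hi (show i ≤ c by omega),
    ← Finset.sum_Ico_consecutive g (show i ≤ i + m - 1 by omega) (show i + m - 1 ≤ c by omega),
    ← Finset.sum_Ico_consecutive f hi (show i ≤ c + 1 - m by omega),
    sum_Ico_shift (m := m) (f := f) (k := i + m - 1) (by omega) (fun j hj => h3 j (by omega))
      (by omega),
    Finset.sum_eq_zero (s := Finset.Ico i (i + m - 1)), show i + m - 1 + 1 - m = i by omega,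
    zero_add]
  · congr 1
    refine Finset.sum_congr rfl fun j hj => ?_
    rw [Finset.mem_Ico] at hj
    exact h1 j hj.1 hj.2
  · intro j hj
    rw [Finset.mem_Ico] at hj
    exact h2 j hj.1 (by omega)

/-! ### Grafting onto a leaf that is not the first one -/

section

variable {r : I} {i : ℕ} {T : MTree n} {S : MTree m}

/-- An interval {1,…,b} that ends among the leaves of S before the last one would cut S, so it has
length 0; every other one is a spine edge of T. -/
lemma spine_graft (h2 : 2 ≤ i) (hi : 1 ≤ i ∧ i ≤ n) (hm : 1 ≤ m) (hN : N + 1 = n + m) (b : ℕ) :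
    (T.graft r i S hi hm hN : MTree N).spine b =
      if b < i then T.spine b else if b + 1 < i + m then 0 else T.spine (b + 1 - m) := by
  by_cases hb : IsCluster N 1 b
  · have hb' := hb
    unfold IsCluster at hb'
    rw [spine_eq _ (by omega) (by omega), len_graft _ _ _ _ _ _ _ hb]
    by_cases h3 : b < i
    · rw [if_neg (by omega), if_neg (by omega), if_pos (by omega), if_pos (by omega), if_pos h3,
        if_pos h3, spine_eq _ (by omega) (by omega)]
    · rw [if_neg (by omega), if_neg (by omega), if_neg h3, if_neg h3, if_pos (show 1 ≤ i by omega)]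
      by_cases h4 : b + 1 < i + m
      · rw [if_neg (by omega), if_pos h4]
      · rw [if_pos (by omega), if_neg h4, spine_eq _ (by omega) (by omega)]
  -- What remains is b = 1, b = N, where the conventional length 1 applies, and b outside {1,…,N},
  -- where both sides are 0.
  · have hb' := hb
    unfold IsCluster at hb'
    by_cases h1 : b = 1
    · rw [h1, if_pos (by omega), spine_one, spine_one]
    · by_cases h3 : b = N
      · rw [if_neg (by omega), if_neg (by omega), h3, show N + 1 - m = n by omega, spine_self,
          spine_self]
      · rw [spine_eq _ h1 h3, len_eq_zero _ hb]
        split_ifs with h4 h5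
        · rw [spine_eq _ (by omega) (by omega), len_eq_zero]
          unfold IsCluster
          omega
        · rfl
        · rw [spine_eq _ (by omega) (by omega), len_eq_zero]
          unfold IsCluster
          omega

lemma sum_spine_graft (h2 : 2 ≤ i) (hi : 1 ≤ i ∧ i ≤ n) (hm : 1 ≤ m) (hN : N + 1 = n + m) {c : ℕ}
    (hc : i + m ≤ c + 1) :
    ∑ j ∈ Finset.Ico 1 c, 2 * (T.graft r i S hi hm hN : MTree N).spine j =
      ∑ j ∈ Finset.Ico 1 (c + 1 - m), 2 * T.spine j := by
  refine sum_Ico_gap (i := i) (by omega) hm ?_ ?_ ?_ hc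
  · intro j _ hj
    rw [spine_graft h2, if_pos hj]
  · intro j hj hj'
    rw [spine_graft h2, if_neg (by omega), if_pos hj', mul_zero]
  · intro j hj _
    rw [spine_graft h2, if_neg (by omega), if_neg (by omega)]

/-- S hangs off the spine and costs no time, so the clock is that of T. -/
lemma spent_graft (h2 : 2 ≤ i) (hi : 1 ≤ i ∧ i ≤ n) (hm : 1 ≤ m) (hN : N + 1 = n + m) (t : ℝ)
    (b : ℕ) :
    (T.graft r i S hi hm hN : MTree N).spent t b =
      if b < i then T.spent t b else if b + 1 < i + m then 0 else T.spent t (b + 1 - m) := by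
  unfold spent
  rw [spine_graft h2]
  split_ifs with h3 h4
  · rw [Finset.sum_congr rfl fun j hj => ?_]
    rw [Finset.mem_Ico] at hj
    rw [spine_graft h2, if_pos (by omega)]
  · rw [mul_zero, max_eq_left (min_le_right _ _)]
  · rw [sum_spine_graft h2 _ _ _ (by omega)]

lemma slideLength_graft (h2 : 2 ≤ i) (hi : 1 ≤ i ∧ i ≤ n) (hm : 1 ≤ m) (hN : N + 1 = n + m) :
    (T.graft r i S hi hm hN : MTree N).slideLength = T.slideLength := by
  rw [slideLength_eq_sum _ (by omega), slideLength_eq_sum _ (by omega),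
    sum_spine_graft h2 _ _ _ (by omega), show N + 1 - m = n by omega]

/-- `σ(T ∘_i^r S) = σ(T) ∘_i^r S` for `i > 1`. -/
lemma slide_graft (h2 : 2 ≤ i) (hi : 1 ≤ i ∧ i ≤ n) (hm : 1 ≤ m) (hN : N + 1 = n + m) (t : ℝ) :
    (T.graft r i S hi hm hN : MTree N).slide t = (T.slide t).graft r i S := by
  refine ext_of_isCluster fun a b h => ?_
  have h' := h
  unfold IsCluster at h'
  rw [len_slide _ _ h, len_graft _ _ _ _ _ _ _ h]
  -- Three kinds of edges: a = 1 for the parts behind the sliding root, b = N + 1 for the parts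
  -- ahead of it, and the edges off the spine.
  by_cases ha : a = 1
  · subst ha
    rw [if_pos rfl, if_neg (by omega), if_neg (by omega), spine_graft h2, spent_graft h2,
      if_pos (show 1 ≤ i by omega)]
    by_cases h3 : b < i
    · rw [if_pos h3, if_pos h3, if_pos h3, if_pos (Or.inl h3),
        len_slide _ _ (by unfold IsCluster; omega), if_pos rfl]
    · by_cases h4 : b + 1 < i + m
      · rw [if_neg h3, if_neg h3, if_neg h3, if_pos h4, if_pos h4, if_neg (by omega), min_self]
      · rw [if_neg h3, if_neg h3, if_neg h3, if_neg h4, if_neg h4, if_pos (by omega),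
          len_slide _ _ (by unfold IsCluster; omega), if_pos rfl]
  · rw [if_neg ha]
    by_cases hb : b = N + 1
    · subst hb
      rw [if_pos rfl, if_neg (by omega), if_neg (by omega), if_neg (show ¬ N + 1 < i by omega),
        spine_graft h2, spent_graft h2]
      by_cases h3 : a ≤ i
      · rw [if_pos (by omega), if_pos (by omega), if_pos (by omega), if_pos h3,
          show N + 1 + 1 - m = n + 1 by omega,
          len_slide _ _ (by unfold IsCluster; omega), if_neg ha, if_pos rfl]
      · by_cases h4 : a < i + m
        · rw [if_neg (show ¬ a - 1 < i by omega), if_neg (show ¬ a - 1 < i by omega),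
            if_pos (show a - 1 + 1 < i + m by omega), if_pos (show a - 1 + 1 < i + m by omega),
            if_neg (by omega), mul_zero, sub_zero, min_self]
        · rw [if_neg (show ¬ a - 1 < i by omega), if_neg (show ¬ a - 1 < i by omega),
            if_neg (show ¬ a - 1 + 1 < i + m by omega), if_neg (show ¬ a - 1 + 1 < i + m by omega),
            if_pos (by omega), if_neg h3, show N + 1 + 1 - m = n + 1 by omega,
            len_slide _ _ (by unfold IsCluster; omega), if_neg (by omega), if_pos rfl,
            show a - 1 + 1 - m = a + 1 - m - 1 by omega]
    · rw [if_neg hb, len_graft _ _ _ _ _ _ _ (by unfold IsCluster; omega)]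
      split_ifs
      all_goals first
        | rfl
        | omega
        | skip
      all_goals
        rw [len_slide _ _ (by unfold IsCluster; omega), if_neg (by omega), if_neg (by omega)]

end

/-! ### Grafting onto the first leaf -/

section

variable {T : MTree n} {S : MTree m}

/-- The grafting edge {1,…,m} has length 1, exactly the conventional length of the first leaf of T.
So the spine is that of S followed by that of T, without an exception at the junction. -/
lemma spine_graft_one (hi : 1 ≤ 1 ∧ 1 ≤ n) (hn : 2 ≤ n) (hm : 2 ≤ m) (hN : N + 1 = n + m) (b : ℕ) :
    (T.graft 1 1 S hi (one_le_two.trans hm) hN : MTree N).spine b =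
      if b < m then S.spine b else T.spine (b + 1 - m) := by
  by_cases hb : IsCluster N 1 b
  · have hb' := hb
    unfold IsCluster at hb'
    rw [spine_eq _ (by omega) (by omega), len_graft _ _ _ _ _ _ _ hb]
    by_cases h3 : b < m
    · rw [if_neg (by omega), if_pos (by omega), if_pos h3, spine_eq _ (by omega) (by omega)]
      rfl
    · rw [if_neg h3]
      by_cases h4 : b = m
      · rw [if_pos (by omega), show b + 1 - m = 1 by omega, spine_one]
        rfl
      · rw [if_neg (by omega), if_neg (by omega), if_pos (by omega), if_pos le_rfl,
          if_neg (by omega), spine_eq _ (by omega) (by omega)]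
  · have hb' := hb
    unfold IsCluster at hb'
    by_cases h1 : b = 1
    · rw [h1, if_pos (by omega), spine_one, spine_one]
    · by_cases h3 : b = N
      · rw [if_neg (by omega), h3, show N + 1 - m = n by omega, spine_self, spine_self]
      · rw [spine_eq _ h1 h3, len_eq_zero _ hb]
        split_ifs with h4 <;>
        · rw [spine_eq _ (by omega) (by omega), len_eq_zero]
          unfold IsCluster
          omega

lemma sum_spine_graft_one (hi : 1 ≤ 1 ∧ 1 ≤ n) (hn : 2 ≤ n) (hm : 2 ≤ m) (hN : N + 1 = n + m)
    {c : ℕ} (hc : m ≤ c) :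
    ∑ j ∈ Finset.Ico 1 c, 2 * (T.graft 1 1 S hi (one_le_two.trans hm) hN : MTree N).spine j =
      S.slideLength + ∑ j ∈ Finset.Ico 1 (c + 1 - m), 2 * T.spine j := by
  rw [← Finset.sum_Ico_consecutive _ (show 1 ≤ m by omega) hc, S.slideLength_eq_sum hm,
    sum_Ico_shift (m := m) (f := fun j => 2 * T.spine j) (k := m) (by omega) _ hc,
    show m + 1 - m = 1 by omega]
  · congr 1
    refine Finset.sum_congr rfl fun j hj => ?_
    rw [Finset.mem_Ico] at hj
    rw [spine_graft_one hi hn hm, if_pos hj.2]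
  · intro j hj _
    rw [spine_graft_one hi hn hm, if_neg (by omega)]

/-- The edges of S below the grafting edge take total time l(S), which is the delay of the clock of
T. -/
lemma spent_graft_one (hi : 1 ≤ 1 ∧ 1 ≤ n) (hn : 2 ≤ n) (hm : 2 ≤ m) (hN : N + 1 = n + m) (t : ℝ)
    (b : ℕ) :
    (T.graft 1 1 S hi (one_le_two.trans hm) hN : MTree N).spent t b =
      if b < m then S.spent t b else T.spent (t - S.slideLength) (b + 1 - m) := by
  unfold spent
  rw [spine_graft_one hi hn hm]
  split_ifs with h3
  · rw [Finset.sum_congr rfl fun j hj => ?_]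
    rw [Finset.mem_Ico] at hj
    rw [spine_graft_one hi hn hm, if_pos (by omega)]
  · rw [sum_spine_graft_one hi hn hm _ (by omega)]
    congr 2
    ring

lemma slideLength_graft_one (hi : 1 ≤ 1 ∧ 1 ≤ n) (hn : 2 ≤ n) (hm : 2 ≤ m) (hN : N + 1 = n + m) :
    (T.graft 1 1 S hi (one_le_two.trans hm) hN : MTree N).slideLength =
      S.slideLength + T.slideLength := by
  rw [slideLength_eq_sum _ (by omega), sum_spine_graft_one hi hn hm _ (by omega),
    T.slideLength_eq_sum hn, show N + 1 - m = n by omega]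

/-- The first part of `σ(T ∘_1 S)`, in which the root slides along `S`. -/
lemma slide_graft_one_of_le (hi : 1 ≤ 1 ∧ 1 ≤ n) (hn : 2 ≤ n) (hm : 2 ≤ m) (hN : N + 1 = n + m)
    {t : ℝ} (ht : t ≤ S.slideLength) :
    (T.graft 1 1 S hi (one_le_two.trans hm) hN : MTree N).slide t =
      (S.slide t).graft 1 (m + 1) T.reroot := by
  refine ext_of_isCluster fun a b h => ?_
  have h' := h
  unfold IsCluster at h'
  rw [len_slide _ _ h, len_graft _ _ _ _ _ _ _ h]
  by_cases ha : a = 1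
  · subst ha
    rw [if_pos rfl, if_neg (by omega), if_neg (by omega), spine_graft_one hi hn hm,
      spent_graft_one hi hn hm, if_pos (show 1 ≤ m + 1 by omega)]
    by_cases h3 : b < m
    · rw [if_pos h3, if_pos h3, if_pos (by omega), if_pos (by omega),
        len_slide _ _ (by unfold IsCluster; omega), if_pos rfl]
    · rw [if_neg h3, if_neg h3]
      by_cases h4 : b = m
      · subst h4
        rw [if_pos (by omega), if_pos (by omega), show b + 1 - b = 1 by omega,
          len_slide _ _ (by unfold IsCluster; omega), if_pos rfl, spine_one, spine_self]
        -- The edge {1,…,m} is at once the root edge of S and the first leaf of T; both clocks read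
        -- t + 1 - l(S) on it.
        unfold spent
        rw [← S.slideLength_eq_sum hm, spine_one, spine_self, Finset.Ico_self, Finset.sum_empty]
        congr 3
        ring
      · rw [if_neg (by omega), spent_eq_zero, min_eq_right (spine_nonneg _ _)]
        -- As t ≤ l(S), at most one of the two time units on the first leaf of T is used up, so no
        -- later edge of T has been reached.
        refine le_trans ?_ (T.sum_spine_mono (show 2 ≤ b + 1 - m by omega))
        rw [Finset.sum_Ico_succ_top le_rfl, Finset.Ico_self, Finset.sum_empty, spine_one]
        linarith
  · rw [if_neg ha]
    by_cases hb : b = N + 1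
    · subst hb
      rw [if_pos rfl, spine_graft_one hi hn hm, spent_graft_one hi hn hm]
      by_cases h3 : a - 1 < m
      · rw [if_pos h3, if_pos h3, if_neg (by omega), if_neg (by omega), if_pos (by omega),
          if_pos (by omega), if_neg (by omega), show N + 1 + 1 - n = m + 1 by omega,
          len_slide _ _ (by unfold IsCluster; omega), if_neg ha, if_pos rfl]
      · rw [if_neg h3, if_neg h3]
        by_cases h4 : a = m + 1
        · subst h4
          rw [if_pos (by omega), show m + 1 - 1 + 1 - m = 1 by omega, spine_one]
          -- During the first half of the time on an edge the part ahead keeps its full length; here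
          -- this is the length 1 of the edge carrying `T.reroot`.
          have : T.spent (t - S.slideLength) 1 ≤ 1 := by
            unfold spent
            rw [Finset.Ico_self, Finset.sum_empty]
            exact max_le zero_le_one ((min_le_left _ _).trans (by linarith))
          rw [min_eq_left (by linarith)]
          rfl
        · rw [if_neg (by omega), if_pos (by omega), len_reroot _ (by unfold IsCluster; omega),
            if_pos (by omega), spent_eq_zero, spine_eq _ (by omega) (by omega), min_eq_left]
          · rw [show a - 1 + 1 - m = a + 1 - (m + 1) by omega]
          · have := T.nonneg 1 (a - 1 + 1 - m)
            linarith
          · refine le_trans ?_ (T.sum_spine_mono (show 2 ≤ a - 1 + 1 - m by omega))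
            rw [Finset.sum_Ico_succ_top le_rfl, Finset.Ico_self, Finset.sum_empty, spine_one]
            linarith
    · rw [if_neg hb, len_graft _ _ _ _ _ _ _ (by unfold IsCluster; omega)]
      by_cases h3 : b ≤ m
      · rw [if_neg (by omega), if_pos (by omega), if_neg (by omega), if_neg (by omega),
          if_pos (by omega), if_pos (by omega), if_pos (by omega),
          len_slide _ _ (by unfold IsCluster; omega), if_neg ha, if_neg (by omega)]
        rfl
      · by_cases h4 : m + 1 ≤ a
        · rw [if_neg (by omega), if_neg (by omega), if_pos (by omega), if_neg (by omega),
            if_neg (by omega), if_neg (by omega), if_pos (by omega),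
            len_reroot _ (by unfold IsCluster; omega), if_neg (by omega),
            show a + 1 - (m + 1) + 1 = a + 1 - m by omega,
            show b + 1 - (m + 1) + 1 = b + 1 - m by omega]
        -- The interval contains leaves m and m + 1 but neither the first nor the last leaf, so it
        -- cuts the grafted tree on either side and has length 0.
        · rw [if_neg (by omega), if_neg (by omega), if_neg (by omega), if_neg (by omega),
            if_neg (by omega), if_neg (by omega)]

/-- The second part of `σ(T ∘_1 S)`, in which the root slides along `T`. -/
lemma slide_graft_one_add (hi : 1 ≤ 1 ∧ 1 ≤ n) (hn : 2 ≤ n) (hm : 2 ≤ m) (hN : N + 1 = n + m)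
    {t : ℝ} (ht : 0 ≤ t) :
    (T.graft 1 1 S hi (one_le_two.trans hm) hN : MTree N).slide (S.slideLength + t) =
      (T.slide t).graft 1 1 S := by
  refine ext_of_isCluster fun a b h => ?_
  have h' := h
  unfold IsCluster at h'
  rw [len_slide _ _ h, len_graft _ _ _ _ _ _ _ h]
  by_cases ha : a = 1
  · subst ha
    rw [if_pos rfl, spine_graft_one hi hn hm, spent_graft_one hi hn hm, add_sub_cancel_left]
    by_cases h3 : b < m
    · rw [if_pos h3, if_pos h3, if_neg (by omega), if_pos (by omega),
        spent_eq_two_mul_of_slideLength_le _ (by omega) h3 (by linarith),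
        min_eq_left (by have := S.spine_nonneg b; linarith), spine_eq _ (by omega) (by omega)]
      rfl
    · rw [if_neg h3, if_neg h3]
      by_cases h4 : b = m
      · subst h4
        rw [if_pos (by omega), show b + 1 - b = 1 by omega, spine_one, min_eq_left]
        · rfl
        -- At least one unit has been spent on the grafting edge, so its part behind the root
        -- already has full length 1.
        · unfold spent
          rw [Finset.Ico_self, Finset.sum_empty, spine_one]
          exact le_max_of_le_right (le_min (by linarith) (by norm_num))
      · rw [if_neg (by omega), if_neg (by omega), if_pos (by omega), if_pos le_rfl,
          if_neg (by omega), len_slide _ _ (by unfold IsCluster; omega), if_pos rfl]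
  · rw [if_neg ha]
    by_cases hb : b = N + 1
    · subst hb
      rw [if_pos rfl, spine_graft_one hi hn hm, spent_graft_one hi hn hm, add_sub_cancel_left]
      by_cases h3 : a - 1 < m
      · rw [if_pos h3, if_pos h3, if_neg (by omega), if_neg (by omega), if_neg (by omega),
          spent_eq_two_mul_of_slideLength_le _ (by omega) h3 (by linarith), sub_self,
          min_eq_right (S.spine_nonneg _)]
      · rw [if_neg h3, if_neg h3, if_neg (by omega), if_neg (by omega), if_pos (by omega),
          if_neg (by omega), if_neg (by omega), show N + 1 + 1 - m = n + 1 by omega,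
            len_slide _ _ (by unfold IsCluster; omega),
          if_neg (by omega), if_pos rfl, show a + 1 - m - 1 = a - 1 + 1 - m by omega]
    · rw [if_neg hb, len_graft _ _ _ _ _ _ _ (by unfold IsCluster; omega)]
      split_ifs
      all_goals first
        | rfl
        | omega
        | skip
      all_goals
        rw [len_slide _ _ (by unfold IsCluster; omega), if_neg (by omega), if_neg (by omega)]

end

/-! ### The ends of the sliding path -/

/-- Only the first leaf has been entered, for one unit: the part of it ahead still has length 1 and
carries the whole tree, seen from its first leaf. The bar relation for the last leaf turns this into
the base point. -/
lemma slide_of_nonpos (T : MTree n) (hn : 1 ≤ n) {t : ℝ} (h0 : 0 ≤ t) (ht : t ≤ 0) :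
    T.slide t = (corolla 2).graft 1 2 T.reroot := by
  obtain rfl : t = 0 := le_antisymm ht h0
  refine ext_of_isCluster fun a b h => ?_
  have h' := h
  unfold IsCluster at h'
  have hsum : ∀ {b : ℕ}, 2 ≤ b → T.spent 0 b = 0 := by
    intro b hb
    refine T.spent_eq_zero (le_trans ?_ (T.sum_spine_mono hb))
    rw [Finset.sum_Ico_succ_top le_rfl, Finset.Ico_self, Finset.sum_empty, spine_one]
    norm_num
  rw [len_slide _ _ h, len_graft _ _ _ _ _ _ _ h]
  by_cases ha : a = 1
  · subst ha
    rw [if_pos rfl, hsum (by omega), min_eq_right (spine_nonneg _ _), if_neg (by omega),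
      if_neg (by omega)]
    split_ifs <;> rfl
  · rw [if_neg ha]
    by_cases hb : b = n + 1
    · subst hb
      rw [if_pos rfl]
      by_cases h2 : a = 2
      · subst h2
        rw [if_pos (by omega), spine_one]
        have : T.spent 0 1 ≤ 1 := by
          unfold spent
          rw [Finset.Ico_self, Finset.sum_empty]
          exact max_le zero_le_one ((min_le_left _ _).trans (by norm_num))
        rw [min_eq_left (by linarith)]
        rfl
      · rw [if_neg (by omega), if_pos (by omega), len_reroot _ (by unfold IsCluster; omega),
          if_pos (by omega), hsum (by omega), spine_eq _ (by omega) (by omega), min_eq_left]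
        · rfl
        · have := T.nonneg 1 (a - 1)
          linarith
    · rw [if_neg hb, if_neg (by omega), if_pos (by omega),
        len_reroot _ (by unfold IsCluster; omega), if_neg (by omega),
        show a + 1 - 2 + 1 = a by omega, show b + 1 - 2 + 1 = b by omega]

/-- All spine edges are passed and have their old lengths back, while the part of the former root
edge behind has reached length 1. This gives both the end point and the stationarity of the loop. -/
lemma slide_of_slideLength_le (T : MTree n) (hn : 1 ≤ n) {t : ℝ} (ht : T.slideLength ≤ t) :
    T.slide t = (corolla 2).graft 1 1 T := by
  refine ext_of_isCluster fun a b h => ?_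
  have h' := h
  unfold IsCluster at h'
  rw [len_slide _ _ h, len_graft _ _ _ _ _ _ _ h]
  by_cases hb : b = n + 1
  · subst hb
    rw [if_neg (by omega), if_pos rfl, if_neg (by omega), if_neg (by omega),
      spent_eq_two_mul_of_slideLength_le _ (by omega) (by omega) ht, sub_self,
      min_eq_right (spine_nonneg _ _)]
    split_ifs <;> rfl
  · by_cases ha : a = 1
    · subst ha
      rw [if_pos rfl]
      by_cases h2 : b = n
      · subst h2
        rw [if_pos (by omega), spine_self, min_eq_left (T.one_le_spent_self (by omega) ht)]
        rfl
      · rw [if_neg (by omega), if_pos (by omega),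
          spent_eq_two_mul_of_slideLength_le _ (by omega) (by omega) ht,
          min_eq_left (by have := T.spine_nonneg b; linarith), spine_eq _ (by omega) h2]
        rfl
    · rw [if_neg ha, if_neg hb, if_neg (by omega), if_pos (by omega)]
      rfl

/-! ### Erasing the last leaf -/

/-- The erased leaf lies outside S. Erasing it can merge the grafting edge with an edge of A, and
then the maximum is 1 because the grafting edge has length 1; a shorter grafting edge could be
lengthened. -/
lemma degen_graft (A : MTree (n + 1)) (S : MTree m) {i : ℕ} (hi : 1 ≤ i ∧ i ≤ n) (hm : 1 ≤ m)
    (hN : N + 1 = n + m) :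
    (A.graft 1 i S ⟨hi.1, hi.2.trans n.le_succ⟩ hm (by omega) : MTree (N + 1)).degen (N + 1) rfl =
      ((A.degen (n + 1) rfl).graft 1 i S hi hm hN : MTree N) := by
  refine ext_of_isCluster fun a b h => ?_
  have h' := h
  unfold IsCluster at h'
  rw [len_degen_last _ h]
  by_cases hb : b = N
  · subst hb
    rw [if_pos rfl]
    by_cases h1 : a = i ∧ b + 1 = i + m
    · rw [len_graft _ _ _ _ _ _ _ (show IsCluster (b + 1) a b by unfold IsCluster; omega),
        if_pos h1, len_graft _ _ _ _ _ _ _ h, if_pos h1]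
      exact max_eq_left (le_one _ _ _)
    · rw [len_graft _ _ _ _ _ _ _ (show IsCluster (b + 1) a b by unfold IsCluster; omega),
        if_neg h1, len_graft _ _ _ _ _ _ _ h, if_neg h1,
        len_graft _ _ _ _ _ _ _ (show IsCluster (b + 1) a (b + 1) by unfold IsCluster; omega),
        if_neg (show ¬ (a = i ∧ b + 1 + 1 = i + m) by omega),
        if_neg (show ¬ (i ≤ a ∧ b + 1 + 1 ≤ i + m) by omega)]
      by_cases h2 : i ≤ a ∧ b + 1 ≤ i + m
      · rw [if_pos h2, if_pos h2, if_neg (by omega), max_eq_left (S.nonneg _ _)]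
      · rw [if_neg h2, if_neg h2]
        by_cases h3 : b < i ∨ i + m ≤ a ∨ (a ≤ i ∧ i + m ≤ b + 1)
        · rw [if_pos h3, if_pos h3,
            if_pos (show b + 1 < i ∨ i + m ≤ a ∨ (a ≤ i ∧ i + m ≤ b + 1 + 1) by omega),
            if_neg (show ¬ b + 1 < i by omega), if_neg (show ¬ b < i by omega),
            show b + 1 + 1 - m = n + 1 by omega, show b + 1 - m = n by omega,
            len_degen_last _ (by unfold IsCluster; split_ifs <;> omega), if_pos rfl]
        · rw [if_neg h3, if_neg h3, if_neg (by omega), max_self]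
  · rw [if_neg hb, len_graft _ _ _ _ _ _ _ h, len_graft _ _ _ _ _ _ _ (by unfold IsCluster; omega)]
    split_ifs
    all_goals first
      | rfl
      | omega
      | skip
    all_goals
      rw [len_degen_last _ (by unfold IsCluster; omega), if_neg (by omega)]

/-- Here the erased leaf belongs to B, which keeps at least one leaf. Again a merger with the
grafting edge of length 1 leaves length 1. -/
lemma degen_graft_last (A : MTree n) (B : MTree (m + 1)) (hn : 1 ≤ n) (hm : 1 ≤ m)
    (hN : N + 1 = n + m) :
    (A.graft 1 n B ⟨hn, le_rfl⟩ (by omega) (by omega) : MTree (N + 1)).degen (N + 1) rfl =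
      (A.graft 1 n (B.degen (m + 1) rfl) ⟨hn, le_rfl⟩ hm hN : MTree N) := by
  refine ext_of_isCluster fun a b h => ?_
  have h' := h
  unfold IsCluster at h'
  rw [len_degen_last _ h]
  by_cases hb : b = N
  · subst hb
    rw [if_pos rfl,
      len_graft _ _ _ _ _ _ _ (show IsCluster (b + 1) a b by unfold IsCluster; omega),
      len_graft _ _ _ _ _ _ _ (show IsCluster (b + 1) a (b + 1) by unfold IsCluster; omega),
      len_graft _ _ _ _ _ _ _ h, if_neg (show ¬ (a = n ∧ b + 1 = n + (m + 1)) by omega)]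
    by_cases h1 : a = n
    · rw [if_pos (show a = n ∧ b + 1 + 1 = n + (m + 1) by omega),
        if_pos (show a = n ∧ b + 1 = n + m by omega)]
      refine max_eq_right ?_
      split_ifs
      all_goals first | exact le_one _ _ _ | exact zero_le_one
    · rw [if_neg (show ¬ (a = n ∧ b + 1 + 1 = n + (m + 1)) by omega),
        if_neg (show ¬ (a = n ∧ b + 1 = n + m) by omega)]
      by_cases h2 : n ≤ a
      · rw [if_pos (show n ≤ a ∧ b + 1 ≤ n + (m + 1) by omega),
          if_pos (show n ≤ a ∧ b + 1 + 1 ≤ n + (m + 1) by omega),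
          if_pos (show n ≤ a ∧ b + 1 ≤ n + m by omega),
          len_degen_last _ (by unfold IsCluster; omega), if_pos (by omega),
          show b + 1 - n = m by omega, show b + 1 + 1 - n = m + 1 by omega]
      · rw [if_neg (show ¬ (n ≤ a ∧ b + 1 ≤ n + (m + 1)) by omega),
          if_neg (show ¬ (n ≤ a ∧ b + 1 + 1 ≤ n + (m + 1)) by omega),
          if_neg (show ¬ (n ≤ a ∧ b + 1 ≤ n + m) by omega),
          if_neg (show ¬ (b < n ∨ n + (m + 1) ≤ a ∨ (a ≤ n ∧ n + (m + 1) ≤ b + 1)) by omega),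
          if_pos (show b + 1 < n ∨ n + (m + 1) ≤ a ∨ (a ≤ n ∧ n + (m + 1) ≤ b + 1 + 1) by omega),
          if_pos (show b < n ∨ n + m ≤ a ∨ (a ≤ n ∧ n + m ≤ b + 1) by omega),
          if_pos (show a ≤ n by omega), if_pos (show a ≤ n by omega),
          if_neg (show ¬ b + 1 < n by omega), if_neg (show ¬ b < n by omega),
          show b + 1 + 1 - (m + 1) = b + 1 - m by omega, max_eq_right (A.nonneg _ _)]
  · rw [if_neg hb, len_graft _ _ _ _ _ _ _ h, len_graft _ _ _ _ _ _ _ (by unfold IsCluster; omega)]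
    split_ifs
    all_goals first
      | rfl
      | omega
      | skip
    all_goals
      rw [len_degen_last _ (by unfold IsCluster; omega), if_neg (by omega)]

lemma slideErase_graft {T : MTree n} {S : MTree m} {i : ℕ} (h2 : 2 ≤ i) (hi : 1 ≤ i ∧ i ≤ n)
    (hm : 1 ≤ m) (hN : N + 1 = n + m) (t : ℝ) :
    (T.graft 1 i S hi hm hN : MTree N).slideErase t = (T.slideErase t).graft 1 i S hi hm hN := by
  unfold slideErase
  rw [slide_graft h2]
  exact degen_graft _ _ _ _ _

/-- The shape of the erased, turned-around T is irrelevant later: it acts on the tip of the cone. -/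
lemma slideErase_graft_one_of_le {T : MTree (n + 1)} {S : MTree m} (hi : 1 ≤ 1 ∧ 1 ≤ n + 1)
    (hn : 1 ≤ n) (hm : 2 ≤ m) (hN : N + 1 = n + 1 + m) {t : ℝ} (ht : t ≤ S.slideLength) :
    (T.graft 1 1 S hi (one_le_two.trans hm) hN : MTree N).slideErase t =
      (S.slide t).graft 1 (m + 1) (T.reroot.degen (n + 1) rfl) := by
  unfold slideErase
  rw [slide_graft_one_of_le hi (by omega) hm hN ht]
  exact degen_graft_last _ _ (by omega) hn (by omega)

lemma slideErase_graft_one_add {T : MTree n} {S : MTree m} (hi : 1 ≤ 1 ∧ 1 ≤ n) (hn : 2 ≤ n)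
    (hm : 2 ≤ m) (hN : N + 1 = n + m) {t : ℝ} (ht : 0 ≤ t) :
    (T.graft 1 1 S hi (one_le_two.trans hm) hN : MTree N).slideErase (S.slideLength + t) =
      (T.slideErase t).graft 1 1 S hi (one_le_two.trans hm) hN := by
  unfold slideErase
  rw [slide_graft_one_add hi hn hm hN ht]
  exact degen_graft _ _ _ _ _

lemma slideErase_of_nonpos (T : MTree (n + 1)) (hn : 1 ≤ n) {t : ℝ} (h0 : 0 ≤ t) (ht : t ≤ 0) :
    T.slideErase t = (corolla 2).graft 1 2 (T.reroot.degen (n + 1) rfl) := by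
  unfold slideErase
  rw [slide_of_nonpos T (by omega) h0 ht]
  exact degen_graft_last _ _ (by omega) hn (by omega)

/-! ### The length and the end point of `λ(T)` -/

/-- The length of the edge with interval `{b + 1, …, n}`; the last leaf counts as an edge of
length `1`. -/
noncomputable def cospine (T : MTree n) (b : ℕ) : ℝ := if b + 1 = n then 1 else T.len (b + 1) n

lemma cospine_nonneg (T : MTree n) (b : ℕ) : 0 ≤ T.cospine b := by
  unfold cospine
  split_ifs
  · exact zero_le_one
  · exact T.nonneg _ _

lemma slideEraseLength_eq (T : MTree n) : T.slideEraseLength =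
    T.slideLength - 1 - ∑ b ∈ Finset.Ico 1 n, min (T.spine b) (T.cospine b) := rfl

/-- The intervals {1,…,c} and {b+1,…,n} overlap without being nested, so they cannot both be edges.
-/
lemma cospine_eq_zero (T : MTree n) {b c : ℕ} (h1 : 1 ≤ b) (hbc : b < c) (hc : c < n)
    (h : T.spine c ≠ 0) : T.cospine b = 0 := by
  rw [cospine, if_neg (by omega)]
  rw [spine_eq _ (by omega) (by omega)] at h
  by_contra h'
  have := T.laminar _ _ _ _ h h'
  unfold Compat at this
  omega

/-- l(T) is twice the spine total, the minima take away at most half of it, and the first leaf alone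
leaves enough to cover the remaining 1. -/
lemma slideEraseLength_nonneg (T : MTree n) (hn : 2 ≤ n) : 0 ≤ T.slideEraseLength := by
  have h1 : ∑ b ∈ Finset.Ico 1 n, min (T.spine b) (T.cospine b) ≤
      ∑ b ∈ Finset.Ico 1 n, T.spine b := Finset.sum_le_sum fun b _ => min_le_left _ _
  have h2 : T.spine 1 ≤ ∑ b ∈ Finset.Ico 1 n, T.spine b :=
    Finset.single_le_sum (f := T.spine) (fun b _ => T.spine_nonneg b)
      (Finset.mem_Ico.2 ⟨le_rfl, by omega⟩)
  rw [spine_one] at h2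
  rw [slideEraseLength_eq, slideLength_eq_sum _ hn, ← Finset.mul_sum]
  linarith

/-- If the edge {1,…,c} has length u > 0, crossing kills the correction terms with b < c, and those
with b > c are at most the time planned for these later edges. So only min(u, v) can be missing at
c, where v is the length of {c+1,…,n}. The part behind is then complete and the part ahead is at
most v. -/
lemma two_mul_spine_sub_le (T : MTree n) {t : ℝ} {c : ℕ} (h1 : 1 ≤ c) (hc : c < n)
    (ht : T.slideEraseLength ≤ t) :
    2 * T.spine c - min (T.spine c) (T.cospine c) ≤ T.spent t c := by
  rcases eq_or_ne (T.spine c) 0 with h | h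
  · rw [h, min_eq_left (T.cospine_nonneg c)]
    simpa using T.spent_nonneg t c
  · have hmin : 0 ≤ min (T.spine c) (T.cospine c) :=
      le_min (T.spine_nonneg c) (T.cospine_nonneg c)
    refine le_max_of_le_right (le_min ?_ (by linarith))
    have e1 := T.slideLength_eq_sum (by omega)
    rw [← Finset.sum_Ico_consecutive _ h1 hc.le, Finset.sum_eq_sum_Ico_succ_bot hc] at e1
    have e2 : ∑ b ∈ Finset.Ico 1 n, min (T.spine b) (T.cospine b) =
        min (T.spine c) (T.cospine c) +
          ∑ b ∈ Finset.Ico (c + 1) n, min (T.spine b) (T.cospine b) := by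
      rw [← Finset.sum_Ico_consecutive _ h1 hc.le, Finset.sum_eq_sum_Ico_succ_bot hc,
        Finset.sum_eq_zero, zero_add]
      intro b hb
      rw [Finset.mem_Ico] at hb
      rw [T.cospine_eq_zero hb.1 hb.2 hc h, min_eq_right (T.spine_nonneg b)]
    have e3 : ∑ b ∈ Finset.Ico (c + 1) n, min (T.spine b) (T.cospine b) ≤
        ∑ b ∈ Finset.Ico (c + 1) n, 2 * T.spine b :=
      Finset.sum_le_sum fun b _ => (min_le_left _ _).trans (by linarith [T.spine_nonneg b])
    rw [slideEraseLength_eq] at ht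
    linarith

/-- The path `λ(T)` ends in `T`. -/
lemma slideErase_of_slideEraseLength_le (T : MTree n) {t : ℝ} (ht : T.slideEraseLength ≤ t) :
    T.slideErase t = T := by
  refine ext_of_isCluster fun a b h => ?_
  have h' := h
  unfold IsCluster at h'
  unfold slideErase
  rw [len_degen_last _ h]
  by_cases hb : b = n
  · subst hb
    -- Erasure merges the edge {a,…,n} of T with what is still ahead of {1,…,a-1}; by now the latter
    -- is no longer than the former, so the maximum is the length in T.
    have h3 := T.two_mul_spine_sub_le (c := a - 1) (by omega) (by omega) ht
    rw [if_pos rfl, len_slide _ _ (by unfold IsCluster; omega), if_neg (by omega),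
      if_neg (by omega), len_slide _ _ (by unfold IsCluster; omega), if_neg (by omega),
      if_pos rfl, max_eq_left]
    have h4 : min (T.spine (a - 1)) (T.cospine (a - 1)) ≤ T.cospine (a - 1) := min_le_right _ _
    refine (min_le_right _ _).trans (le_trans (by linarith) (h4.trans_eq ?_))
    rw [cospine, if_neg (by omega), show a - 1 + 1 = a by omega]
  · rw [if_neg hb, len_slide _ _ (by unfold IsCluster; omega)]
    by_cases ha : a = 1
    · subst ha
      have h3 := T.two_mul_spine_sub_le (c := b) (by omega) (by omega) ht
      have h4 : min (T.spine b) (T.cospine b) ≤ T.spine b := min_le_left _ _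
      rw [if_pos rfl, min_eq_left (by linarith), spine_eq _ (by omega) hb]
    · rw [if_neg ha, if_neg (by omega)]

/-- A final interval that starts inside S after its first leaf can be an edge only if S sits on the
last leaf of T. For b + 1 = i = n it is the grafting edge, whose length 1 agrees with the convention
for the last leaf. -/
lemma cospine_graft {T : MTree n} {S : MTree m} {i : ℕ} (hi : 1 ≤ i ∧ i ≤ n)
    (hm : 2 ≤ m) (hN : N + 1 = n + m) {b : ℕ} (hb : 1 ≤ b) (hbN : b < N) :
    (T.graft 1 i S hi (one_le_two.trans hm) hN : MTree N).cospine b =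
      if b < i then T.cospine b
      else if b + 1 < i + m then (if b + 1 = N then 1 else if i = n then S.len (b + 2 - i) m else 0)
      else T.cospine (b + 1 - m) := by
  unfold cospine
  by_cases h1 : b + 1 = N
  · rw [if_pos h1, if_pos h1]
    split_ifs with h2 h3 h4 h5
    all_goals first
      | rfl
      | omega
  · rw [if_neg h1, if_neg h1, len_graft _ _ _ _ _ _ _ (by unfold IsCluster; omega)]
    by_cases h2 : b < i
    · rw [if_pos h2]
      by_cases h3 : b + 1 = n
      · rw [if_pos h3, if_pos (by omega)]
        rfl
      · rw [if_neg h3, if_neg (by omega), if_neg (by omega), if_pos (by omega), if_pos (by omega),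
          if_neg (by omega), show N + 1 - m = n by omega]
    · rw [if_neg h2, if_neg (by omega)]
      by_cases h3 : b + 1 < i + m
      · rw [if_pos h3]
        by_cases h4 : i = n
        · rw [if_pos (by omega), if_pos h4, show N + 1 - i = m by omega]
        · rw [if_neg (by omega), if_neg (by omega), if_neg h4]
      · rw [if_neg h3, if_neg (by omega), if_pos (by omega), if_neg (by omega), if_neg (by omega),
          if_neg (by omega), show N + 1 - m = n by omega,
          show b + 1 + 1 - m = b + 1 - m + 1 by omega]

/-- Where the cospine may pick up lengths from S, the spine is 0, so the minima do not see them. -/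
lemma slideEraseLength_graft {T : MTree n} {S : MTree m} {i : ℕ} (h2 : 2 ≤ i)
    (hi : 1 ≤ i ∧ i ≤ n) (hm : 2 ≤ m) (hN : N + 1 = n + m) :
    (T.graft 1 i S hi (one_le_two.trans hm) hN : MTree N).slideEraseLength =
      T.slideEraseLength := by
  rw [slideEraseLength_eq, slideEraseLength_eq, slideLength_graft h2]
  congr 1
  rw [sum_Ico_gap (i := i) (m := m) (f := fun b => min (T.spine b) (T.cospine b)) (by omega)
    (by omega) _ _ _ (by omega), show N + 1 - m = n by omega]
  · intro j h1 hj
    rw [spine_graft h2, cospine_graft hi hm hN h1 (by omega), if_pos hj, if_pos hj]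
  · intro j h1 hj
    rw [spine_graft h2, if_neg (by omega), if_pos hj, min_eq_left (cospine_nonneg _ _)]
  · intro j hj hjN
    rw [spine_graft h2, cospine_graft hi hm hN (by omega) hjN, if_neg (by omega),
      if_neg (by omega), if_neg (by omega), if_neg (by omega)]

/-- A final interval starting inside S after its first leaf would cross the grafting edge {1,…,m},
so the correction comes from T alone and S contributes its full sliding time. -/
lemma slideEraseLength_graft_one {T : MTree n} {S : MTree m} (hi : 1 ≤ 1 ∧ 1 ≤ n) (hn : 2 ≤ n)
    (hm : 2 ≤ m) (hN : N + 1 = n + m) :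
    (T.graft 1 1 S hi (one_le_two.trans hm) hN : MTree N).slideEraseLength =
      S.slideLength + T.slideEraseLength := by
  rw [slideEraseLength_eq, slideEraseLength_eq, slideLength_graft_one hi hn hm,
    ← Finset.sum_Ico_consecutive _ (show 1 ≤ m by omega) (show m ≤ N by omega),
    Finset.sum_eq_zero (s := Finset.Ico 1 m),
    Finset.sum_congr rfl (s₁ := Finset.Ico m N)
      (g := fun j => min (T.spine (j + 1 - m)) (T.cospine (j + 1 - m))),
    sum_Ico_shift (m := m) (f := fun b => min (T.spine b) (T.cospine b)) (k := m) (by omega)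
      (fun _ _ _ => rfl) (by omega), show m + 1 - m = 1 by omega, show N + 1 - m = n by omega]
  · ring
  · intro j hj
    rw [Finset.mem_Ico] at hj
    rw [spine_graft_one hi hn hm, cospine_graft hi hm hN (by omega) hj.2, if_neg (by omega),
      if_neg (by omega), if_neg (by omega)]
  · intro j hj
    rw [Finset.mem_Ico] at hj
    rw [cospine_graft hi hm hN hj.1 (by omega), if_neg (by omega), if_pos (by omega),
      if_neg (by omega), if_neg (by omega), min_eq_right (spine_nonneg _ _)]

/-! ### Continuity -/

lemma continuous_len (a b : ℕ) : Continuous fun T : MTree n => T.len a b :=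
  (continuous_apply b).comp ((continuous_apply a).comp continuous_induced_dom)

lemma continuous_mk {C : Type*} [TopologicalSpace C] {f : C → MTree n}
    (h : ∀ a b, IsCluster n a b → Continuous fun c => (f c).len a b) : Continuous f := by
  refine continuous_induced_rng.2 (continuous_pi fun a => continuous_pi fun b => ?_)
  by_cases hab : IsCluster n a b
  · exact h a b hab
  · simp only [Function.comp_def, len_eq_zero _ hab]
    exact continuous_const

lemma continuous_spine (b : ℕ) : Continuous fun T : MTree n => T.spine b := by
  unfold spine
  split_ifs
  · exact continuous_const
  · exact continuous_len 1 b

lemma continuous_slideLength : Continuous fun T : MTree n => T.slideLength :=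
  continuous_const.mul (continuous_const.add (continuous_finsetSum _ fun b _ => continuous_len 1 b))

lemma continuous_slideEraseLength : Continuous fun T : MTree n => T.slideEraseLength := by
  unfold slideEraseLength
  refine (continuous_slideLength.sub continuous_const).sub (continuous_finsetSum _ fun b _ =>
    (continuous_spine b).min ?_)
  split_ifs
  · exact continuous_const
  · exact continuous_len _ _

lemma continuous_spent (b : ℕ) : Continuous fun q : MTree n × ℝ => q.1.spent q.2 b := by
  have h := fun j => (continuous_spine (n := n) j).comp (continuous_fst (X := MTree n) (Y := ℝ))
  exact continuous_const.max (((continuous_snd.add continuous_const).sub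
    (continuous_finsetSum _ fun j _ => continuous_const.mul (h j))).min
      (continuous_const.mul (h b)))

lemma continuous_slide : Continuous fun q : MTree n × ℝ => q.1.slide q.2 := by
  have h := fun j => (continuous_spine (n := n) j).comp (continuous_fst (X := MTree n) (Y := ℝ))
  refine continuous_mk fun a b hab => ?_
  simp only [len_slide _ _ hab]
  split_ifs
  · exact (h b).min (continuous_spent b)
  · exact (h (a - 1)).min ((continuous_const.mul (h (a - 1))).sub (continuous_spent (a - 1)))
  · exact (continuous_len a b).comp continuous_fst

lemma continuous_slideErase : Continuous fun q : MTree n × ℝ => q.1.slideErase q.2 := by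
  refine continuous_mk fun a b hab => ?_
  unfold slideErase
  simp only [len_degen_last _ hab]
  have h := fun a b => (continuous_len a b).comp (continuous_slide (n := n))
  split_ifs
  · exact (h a n).max (h a (n + 1))
  · exact h a b

end MTree

/-! ## Continuity of maps into Moore paths -/

/-- The map is itself one of the test maps that define the finer topology. -/
lemma continuous_to_compactlyGenerated {K : CompHaus.{u}} {Z : Type u} [TopologicalSpace Z]
    {f : K → Z} (hf : Continuous f) :
    @Continuous _ _ _ (TopologicalSpace.compactlyGenerated.{u} Z) f := by
  let F : (Σ (i : (K : CompHaus.{u}) × C(K, Z)), i.fst) → Z := fun p => p.1.2 p.2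
  have hF : @Continuous _ _ _ (TopologicalSpace.compactlyGenerated.{u} Z) F :=
    continuous_coinduced_rng
  exact (@continuous_sigma_iff _ _ _ _ (TopologicalSpace.compactlyGenerated.{u} Z) _).1 hF
    ⟨K, ⟨f, hf⟩⟩

lemma continuous_compactlyGenerated_id (Z : Type u) [t : TopologicalSpace Z] :
    @Continuous _ _ (TopologicalSpace.compactlyGenerated.{u} Z) t id :=
  continuous_from_compactlyGenerated _ fun _ g => g.2

/-- The product is locally compact Hausdorff. This lets adjoints of families of Moore paths map
continuously into compactly generated products. -/
lemma compactlyGeneratedSpace_prod_nnreal (K : Type u) [TopologicalSpace K] [CompactSpace K]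
    [T2Space K] : CompactlyGeneratedSpace (K × ℝ≥0) :=
  inferInstance

instance (K : CompHaus.{u}) : UCompactlyGeneratedSpace.{u} (K × ℝ≥0) :=
  compactlyGeneratedSpace_prod_nnreal K

section Moore

variable {B : Type u} [TopologicalSpace B]

lemma MoorePath.continuous_path_length :
    Continuous fun γ : MoorePath B => (γ.path, γ.length) :=
  @Continuous.comp _ _ _ _
    (TopologicalSpace.induced (fun γ : MoorePath B => (γ.path, γ.length)) inferInstance) _ _ _
    continuous_induced_dom (@continuous_compactlyGenerated_id _ (TopologicalSpace.induced _ _))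

lemma MoorePath.continuous_of_compHaus {K : CompHaus.{u}} {f : K → MoorePath B}
    (hp : Continuous fun s => (f s).path) (hl : Continuous fun s => (f s).length) :
    Continuous f :=
  @continuous_to_compactlyGenerated _ _ (TopologicalSpace.induced _ _) _
    (continuous_induced_rng.2 (hp.prodMk hl))

variable {b : B} {A : Set B}

lemma RelMooreLoop.continuous_of_compHaus {K : CompHaus.{u}} {f : K → RelMooreLoop B b A}
    (hp : Continuous fun s => (f s).path) (hl : Continuous fun s => (f s).length) :
    Continuous f :=
  @continuous_to_compactlyGenerated _ _ (TopologicalSpace.induced _ _) _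
    (continuous_induced_rng.2 (MoorePath.continuous_of_compHaus hp hl))

/-- A map from a space with the compactly generated topology to relative Moore loops is continuous
if its adjoint and the lengths are continuous along all maps from compact Hausdorff spaces. -/
lemma Kify.continuous_relMooreLoop {C : Type u} [TopologicalSpace C]
    {f : Kify C → RelMooreLoop B b A}
    (hp : ∀ (K : CompHaus.{u}) (g : C(K, C)),
      Continuous fun q : K × ℝ≥0 => (f (.of (g q.1))).path q.2)
    (hl : ∀ (K : CompHaus.{u}) (g : C(K, C)), Continuous fun s => (f (.of (g s))).length) :
    Continuous f :=
  Kify.continuous_from fun K g => RelMooreLoop.continuous_of_compHaus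
    (ContinuousMap.curry ⟨_, hp K g⟩).continuous (hl K g)

variable {B' : Type u} [TopologicalSpace B']

/-- Postcomposition is continuous for the compact-open topology; the refinements of the topology for
loops and for paths are handled by testing on compact Hausdorff spaces. -/
lemma MooreLoop.continuous_map (g : C(B, B')) :
    Continuous (MooreLoop.map g : MooreLoop B b → MooreLoop B' (g b)) := by
  refine @continuous_from_compactlyGenerated _ _ (TopologicalSpace.induced _ _) _ _ fun K h => ?_
  have h1 : Continuous (RelMooreLoop.toMoorePath ∘ h) :=
    @Continuous.comp _ _ _ _ (TopologicalSpace.induced RelMooreLoop.toMoorePath inferInstance) _ _ _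
      continuous_induced_dom
      (@ContinuousMap.continuous _ _ _ (TopologicalSpace.induced _ _) h)
  have h2 := MoorePath.continuous_path_length.comp h1
  exact RelMooreLoop.continuous_of_compHaus
    ((ContinuousMap.continuous_postcomp g).comp (continuous_fst.comp h2)) (continuous_snd.comp h2)

lemma MooreLoop.map_mul (g : C(B, B')) (γ δ : MooreLoop B b) :
    MooreLoop.map g (γ * δ) = MooreLoop.map g γ * MooreLoop.map g δ := by
  refine RelMooreLoop.ext (ContinuousMap.ext fun t => ?_) rfl
  exact apply_ite g (t ≤ γ.length) _ _

lemma IsAInftyMap.map {X : Type u} [TopologicalSpace X] {S : AInftySpace X}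
    {f : ∀ n : ℕ, MTree (n + 1) → (Fin n → X) → MooreLoop B b} (hf : IsAInftyMap S f)
    (g : C(B, B')) : IsAInftyMap S fun n T x => MooreLoop.map g (f n T x) where
  continuous n hn := (MooreLoop.continuous_map g).comp (hf.continuous n hn)
  graft a m c hm ρ τ x y z := congrArg _ (hf.graft a m c hm ρ τ x y z)
  graft_first m n hm hn ρ τ x y :=
    (congrArg _ (hf.graft_first m n hm hn ρ τ x y)).trans (MooreLoop.map_mul g _ _)

end Moore

/-! ## Points of the bar construction -/

namespace Bar

variable {Q X P : Type u} {R : ∀ k : ℕ, MTree (k + 1) → Q → (Fin k → X) → Q}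
  {M : ∀ n : ℕ, MTree n → (Fin n → X) → X}
  {N : ∀ k : ℕ, MTree (k + 1) → (Fin k → X) → P → P}

lemma continuous_mk [TopologicalSpace Q] [TopologicalSpace X] [TopologicalSpace P]
    {C : Type*} [TopologicalSpace C] [UCompactlyGeneratedSpace.{u} C] {n : ℕ}
    {T : C → MTree (n + 2)} {q : C → Q} {x : C → Fin n → X} {p : C → P} (hT : Continuous T)
    (hq : Continuous q) (hx : Continuous x) (hp : Continuous p) :
    Continuous fun c => (Bar.mk (T c) (q c) (x c) (p c) : Bar R M N) :=
  continuous_quot_mk.comp (continuous_sigmaMk.comp (Kify.continuous_of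
    (f := fun c => (T c, q c, x c, p c)) (hT.prodMk (hq.prodMk (hx.prodMk hp)))))

lemma mk_graft_first {m n : ℕ} (ρ : MTree (n + 2)) (τ : MTree (m + 1)) (q : Q) (x : Fin m → X)
    (y : Fin n → X) (p : P) :
    (mk (n := m + n) (ρ.graft 1 1 τ) q (Fin.append x y) p : Bar R M N) =
      mk ρ (R m τ q x) y p :=
  Quot.sound (BarRel.left m n ρ τ q x y p)

lemma mk_graft_middle {a m b : ℕ} (hm : 1 ≤ m) (ρ : MTree (a + 1 + b + 2)) (τ : MTree m) (q : Q)
    (x : Fin a → X) (y : Fin m → X) (z : Fin b → X) (p : P) :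
    (mk (n := a + m + b) (ρ.graft 1 (a + 2) τ) q (Fin.append (Fin.append x y) z) p : Bar R M N) =
      mk ρ q (insertAt x (M m τ y) z) p :=
  Quot.sound (BarRel.middle a m b hm ρ τ q x y z p)

lemma mk_graft_last {n m : ℕ} (ρ : MTree (n + 2)) (τ : MTree (m + 1)) (q : Q) (x : Fin n → X)
    (y : Fin m → X) (p : P) :
    (mk (n := n + m) (ρ.graft 1 (n + 2) τ) q (Fin.append x y) p : Bar R M N) =
      mk ρ q x (N m τ y p) :=
  Quot.sound (BarRel.right n m ρ τ q x y p)

lemma mk_corolla_graft_first {n : ℕ} (τ : MTree (n + 1)) (q : Q) (x : Fin n → X) (p : P) :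
    (mk (n := n) ((MTree.corolla 2).graft 1 1 τ) q x p : Bar R M N) =
      mk (n := 0) (MTree.corolla 2) (R n τ q x) Fin.elim0 p := by
  rw [← mk_graft_first (MTree.corolla 2) τ q x Fin.elim0 p, Fin.append_elim0]
  rfl

lemma mk_corolla_graft_last {n : ℕ} (τ : MTree (n + 1)) (q : Q) (x : Fin n → X) (p : P) :
    (mk (n := n) ((MTree.corolla 2).graft 1 2 τ) q x p : Bar R M N) =
      mk (n := 0) (MTree.corolla 2) q Fin.elim0 (N n τ x p) := by
  rw [← mk_graft_last (MTree.corolla 2) τ q Fin.elim0 x p, Fin.elim0_append]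
  -- The relation lives in index 0 + n, which equals n only propositionally; with a variable k the
  -- transport disappears by substitution.
  have key : ∀ {k : ℕ} (h : k = n) (hN : k + 2 + 1 = 2 + (n + 1)),
      (mk (n := n) ((MTree.corolla 2).graft 1 2 τ) q x p : Bar R M N) =
        mk (n := k) ((MTree.corolla 2).graft 1 2 τ (by omega) (by omega) hN) q (x ∘ Fin.cast h)
          p := by
    rintro k rfl _
    rfl
  exact key _ _

end Bar

/-! ## The sliding loops -/

section

variable {X : Type u} [TopologicalSpace X] (S : AInftySpace X)

/-- The length `l(T)` as a nonnegative real number. -/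
noncomputable def MTree.nnSlideLength {n : ℕ} (T : MTree n) : ℝ≥0 :=
  ⟨T.slideLength, zero_le_two.trans T.two_le_slideLength⟩

lemma MTree.coe_nnSlideLength {n : ℕ} (T : MTree n) : (T.nnSlideLength : ℝ) = T.slideLength := rfl

lemma MTree.continuous_nnSlideLength {n : ℕ} : Continuous fun T : MTree n => T.nnSlideLength :=
  MTree.continuous_slideLength.subtype_mk _

/-- The Moore loop `t ↦ [σ(T)(t); *, x, *]` in `BX`, of length `l(T)`. -/
noncomputable def slideLoop (n : ℕ) (T : MTree (n + 1)) (x : Fin n → X) :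
    MooreLoop (ClassifyingSpace S) (ClassifyingSpace.base S) where
  path := ⟨fun t => Bar.mk (T.slide t) ⟨⟩ x ⟨⟩, Bar.continuous_mk
    (MTree.continuous_slide.comp (continuous_const.prodMk NNReal.continuous_coe)) continuous_const
    continuous_const continuous_const⟩
  length := T.nnSlideLength
  stationary t ht := by
    have ht : T.slideLength ≤ t := ht
    simp only [ContinuousMap.coe_mk, MTree.coe_nnSlideLength]
    rw [T.slide_of_slideLength_le (by omega) ht, T.slide_of_slideLength_le (by omega) le_rfl]
  start := by
    simp only [ContinuousMap.coe_mk, NNReal.coe_zero]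
    rw [T.slide_of_nonpos (by omega) le_rfl le_rfl]
    exact Bar.mk_corolla_graft_last _ _ _ _
  finish := by
    simp only [ContinuousMap.coe_mk, MTree.coe_nnSlideLength]
    rw [T.slide_of_slideLength_le (by omega) le_rfl]
    exact Bar.mk_corolla_graft_first _ _ _ _

lemma isAInftyMap_slideLoop : IsAInftyMap S (slideLoop S) where
  continuous n _ := by
    refine Kify.continuous_relMooreLoop (fun K g => ?_) fun K g => ?_
    · have hg : Continuous fun q : K × ℝ≥0 => g q.1 := g.continuous.comp continuous_fst
      exact Bar.continuous_mk (MTree.continuous_slide.comp ((continuous_fst.comp hg).prodMk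
        (NNReal.continuous_coe.comp continuous_snd))) continuous_const (continuous_snd.comp hg)
        continuous_const
    · exact MTree.continuous_nnSlideLength.comp (continuous_fst.comp g.continuous)
  graft a m b hm ρ τ x y z := by
    refine RelMooreLoop.ext (ContinuousMap.ext fun t => ?_) (NNReal.eq ?_)
    · exact (congrArg (fun T => Bar.mk T _ _ _) (MTree.slide_graft (by omega) _ _ _ _)).trans
        (Bar.mk_graft_middle (by omega) (ρ.slide t) τ _ x y z _)
    · exact MTree.slideLength_graft (by omega) _ _ _
  graft_first m n hm hn ρ τ x y := by
    refine RelMooreLoop.ext (ContinuousMap.ext fun t => ?_) (NNReal.eq ?_)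
    · change _ = if t ≤ (slideLoop S m τ x).length then (slideLoop S m τ x).path t
        else (slideLoop S n ρ y).path (t - (slideLoop S m τ x).length)
      split_ifs with h
      -- The turned-around `ρ`, together with y, acts on the point on the right and drops out,
      -- leaving the loop of `τ`.
      · exact (congrArg (fun T => Bar.mk T _ _ _)
          (MTree.slide_graft_one_of_le _ (by omega) (by omega) (by omega) h)).trans
          (Bar.mk_graft_last (τ.slide t) ρ.reroot _ x y _)
      · have h' : τ.slideLength ≤ t := le_of_not_ge h
        have e : ((t - (slideLoop S m τ x).length : ℝ≥0) : ℝ) = t - τ.slideLength :=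
          NNReal.coe_sub h'
        have e' : (t : ℝ) = τ.slideLength + ((t - (slideLoop S m τ x).length : ℝ≥0) : ℝ) := by
          rw [e]
          ring
        exact ((congrArg (fun s : ℝ => Bar.mk (MTree.slide _ s) _ _ _) e').trans
          (congrArg (fun T => Bar.mk T _ _ _) (MTree.slide_graft_one_add _ (by omega) (by omega)
            (by omega) (NNReal.coe_nonneg _)))).trans
          (Bar.mk_graft_first (ρ.slide _) τ _ x y _)
    · exact MTree.slideLength_graft_one _ (by omega) (by omega) _

lemma slide_corolla_two (t : I) :
    (MTree.corolla 2).slide t = (MTree.corolla 2).graft (σ t) 2 (MTree.corolla 2) := by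
  refine MTree.ext_of_isCluster fun a b h => ?_
  have h' := h
  unfold IsCluster at h'
  have ht := t.2.1
  have ht' := t.2.2
  rw [MTree.len_slide _ _ h, MTree.len_graft _ _ _ _ _ _ _ h]
  -- These are the only possible internal edges of a tree with three leaves.
  obtain ⟨rfl, rfl⟩ | ⟨rfl, rfl⟩ : (a = 1 ∧ b = 2) ∨ (a = 2 ∧ b = 3) := by omega
  · rw [if_pos rfl, MTree.spent_eq_zero, min_eq_right (MTree.spine_nonneg _ _)]
    · rfl
    · norm_num [MTree.spine]
      linarith
  · have e : (MTree.corolla 2).spent t 1 = t + 1 := by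
      norm_num [MTree.spent]
      rw [min_eq_left (by linarith), max_eq_right (by linarith)]
    norm_num
    rw [e, min_eq_right (by linarith)]
    ring

lemma slide_corolla_two_one_add (t : I) :
    (MTree.corolla 2).slide (1 + t) = (MTree.corolla 2).graft t 1 (MTree.corolla 2) := by
  refine MTree.ext_of_isCluster fun a b h => ?_
  have h' := h
  unfold IsCluster at h'
  have ht := t.2.1
  have ht' := t.2.2
  rw [MTree.len_slide _ _ h, MTree.len_graft _ _ _ _ _ _ _ h]
  obtain ⟨rfl, rfl⟩ | ⟨rfl, rfl⟩ : (a = 1 ∧ b = 2) ∨ (a = 2 ∧ b = 3) := by omega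
  · have e : (MTree.corolla 2).spent (1 + t) 2 = t := by
      norm_num [MTree.spent]
      rw [min_eq_left (by linarith), max_eq_right (by linarith)]
      ring
    norm_num
    rw [e, min_eq_right ht']
  · have e : (MTree.corolla 2).spent (1 + t) 1 = 2 := by
      norm_num [MTree.spent]
      rw [min_eq_right (by linarith), max_eq_right (by norm_num)]
    norm_num [e]

lemma isUsualMap_slideLoop : IsUsualMap S fun x => slideLoop S 1 (MTree.corolla 2) fun _ => x := by
  refine fun x => ⟨NNReal.eq ?_, fun t => ⟨?_, ?_⟩⟩
  · change 2 * (1 + ∑ b ∈ Finset.Ico 2 2, (MTree.corolla 2).len 1 b) = 2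
    simp
  · exact congrArg (fun T => Bar.mk T _ _ _) (slide_corolla_two t)
  · exact congrArg (fun T => Bar.mk T _ _ _) (slide_corolla_two_one_add t)

end

/-! ## The equivariance of `p ↦ γ_p` -/

section

variable {X P : Type u} [TopologicalSpace X] [TopologicalSpace P]

lemma Cone.continuous_mk_comp {C : Type*} [TopologicalSpace C] [UCompactlyGeneratedSpace.{u} C]
    {p : C → P} {t : C → I} (hp : Continuous p) (ht : Continuous t) :
    Continuous fun c => Cone.mk (p c) (t c) :=
  continuous_quot_mk.comp (Kify.continuous_of (f := fun c => (p c, t c)) (hp.prodMk ht))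

variable [Nonempty P] {S : AInftySpace X} (A : AInftyAction S P)

lemma Cone.mk_projIcc_of_nonpos (p : P) {t : ℝ} (ht : t ≤ 0) :
    Cone.mk p (Set.projIcc 0 1 zero_le_one t) = Cone.tip P :=
  (congrArg (Cone.mk p) (Set.projIcc_of_le_left _ ht)).trans (Cone.mk_zero p)

/-- The length of `λ(T)` as a nonnegative real number. -/
noncomputable def MTree.nnSlideEraseLength {n : ℕ} (T : MTree (n + 2)) : ℝ≥0 :=
  ⟨T.slideEraseLength, T.slideEraseLength_nonneg (Nat.le_add_left 2 n)⟩

lemma MTree.coe_nnSlideEraseLength {n : ℕ} (T : MTree (n + 2)) :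
    (T.nnSlideEraseLength : ℝ) = T.slideEraseLength := rfl

lemma MTree.continuous_nnSlideEraseLength {n : ℕ} :
    Continuous fun T : MTree (n + 2) => T.nnSlideEraseLength :=
  MTree.continuous_slideEraseLength.subtype_mk _

/-- The Moore path `t ↦ [λ(T)(t); *, x, [p, 0]]` followed by `t ↦ [T; *, x, [p, t]]`. -/
noncomputable def slideConeLoop (n : ℕ) (T : MTree (n + 2)) (x : Fin n → X) (p : P) :
    A.OrbitRelLoop where
  -- One formula covers both pieces: the clamped cone coordinate is 0 until λ(T) has arrived, and
  -- from then on λ(T) stays at T.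
  path := ⟨fun t => Bar.mk (T.slideErase t) ⟨⟩ x
      (Cone.mk p (Set.projIcc 0 1 zero_le_one ((t : ℝ) - T.slideEraseLength))),
    Bar.continuous_mk
      (MTree.continuous_slideErase.comp (continuous_const.prodMk NNReal.continuous_coe))
      continuous_const continuous_const (Cone.continuous_mk_comp continuous_const
        (continuous_projIcc.comp (NNReal.continuous_coe.sub continuous_const)))⟩
  length := T.nnSlideEraseLength + 1
  stationary t ht := by
    have ht : T.slideEraseLength + 1 ≤ t := ht
    simp only [ContinuousMap.coe_mk, NNReal.coe_add, MTree.coe_nnSlideEraseLength, NNReal.coe_one]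
    rw [T.slideErase_of_slideEraseLength_le (by linarith),
      T.slideErase_of_slideEraseLength_le (by linarith),
      Set.projIcc_of_right_le _ (by linarith), Set.projIcc_of_right_le _ (by linarith)]
  start := by
    have h := T.slideEraseLength_nonneg (by omega)
    simp only [ContinuousMap.coe_mk, NNReal.coe_zero]
    rw [Cone.mk_projIcc_of_nonpos _ (by linarith),
      T.slideErase_of_nonpos (by omega) le_rfl le_rfl]
    exact (Bar.mk_corolla_graft_last _ _ _ _).trans
      (congrArg (Bar.mk (MTree.corolla 2) _ Fin.elim0) (Cone.mk_zero _))
  finish := by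
    simp only [ContinuousMap.coe_mk, NNReal.coe_add, MTree.coe_nnSlideEraseLength, NNReal.coe_one]
    rw [T.slideErase_of_slideEraseLength_le (by linarith),
      Set.projIcc_of_right_le _ (by linarith)]
    exact ⟨Bar.mk T ⟨⟩ x p, rfl⟩

lemma slideConeLoop_path (n : ℕ) (T : MTree (n + 2)) (x : Fin n → X) (p : P) (t : ℝ≥0) :
    (slideConeLoop A n T x p).path t =
      if (t : ℝ) ≤ T.slideEraseLength then Bar.mk (T.slideErase t) ⟨⟩ x (Cone.tip P)
      else Bar.mk T ⟨⟩ x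
        (Cone.mk p (Set.projIcc 0 1 zero_le_one ((t : ℝ) - T.slideEraseLength))) := by
  change Bar.mk (T.slideErase t) _ x _ = _
  split_ifs with h
  · rw [Cone.mk_projIcc_of_nonpos _ (by linarith)]
  · rw [T.slideErase_of_slideEraseLength_le (le_of_not_ge h)]

lemma isAInftyEquivariance_slideConeLoop : IsAInftyEquivariance A
    (fun n T x => MooreLoop.map A.tipMap (slideLoop S n T x)) A.gamma (slideConeLoop A) where
  continuous n := by
    refine Kify.continuous_relMooreLoop (fun K g => ?_) fun K g => ?_
    · have hg : Continuous fun q : K × ℝ≥0 => g q.1 := g.continuous.comp continuous_fst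
      have ht : Continuous fun q : K × ℝ≥0 => (q.2 : ℝ) :=
        NNReal.continuous_coe.comp continuous_snd
      exact Bar.continuous_mk
        (MTree.continuous_slideErase.comp ((continuous_fst.comp hg).prodMk ht)) continuous_const
        (continuous_fst.comp (continuous_snd.comp hg))
        (Cone.continuous_mk_comp (continuous_snd.comp (continuous_snd.comp hg))
          (continuous_projIcc.comp
            (ht.sub (MTree.continuous_slideEraseLength.comp (continuous_fst.comp hg)))))
    · exact (MTree.continuous_nnSlideEraseLength.comp
        (continuous_fst.comp g.continuous)).add continuous_const
  one p := by
    -- l(δ_2) = 2, and the two leaves at the root vertex give u = v = 1, so 2 - 1 - 1 = 0 and only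
    -- the cone part is left.
    have h0 : (MTree.corolla 2).slideEraseLength = 0 := by
      norm_num [MTree.slideEraseLength, MTree.slideLength]
    refine RelMooreLoop.ext (ContinuousMap.ext fun t => ?_) (NNReal.eq ?_)
    · change Bar.mk _ _ _ (Cone.mk p (Set.projIcc 0 1 _ ((t : ℝ) - _))) = Bar.mk _ _ _ _
      rw [h0, sub_zero]
      exact congrArg (fun T => Bar.mk T _ _ _)
        (MTree.slideErase_of_slideEraseLength_le _ (h0.trans_le t.2))
    · change (MTree.corolla 2).slideEraseLength + 1 = 1
      rw [h0, zero_add]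
  graft a m b hm τ ρ x y z p := by
    have hL : (τ.graft 1 (a + 2) ρ : MTree (a + m + b + 2)).slideEraseLength =
      τ.slideEraseLength := MTree.slideEraseLength_graft (by omega) _ hm _
    refine RelMooreLoop.ext (ContinuousMap.ext fun t => ?_)
      (NNReal.eq (congrArg (fun r : ℝ => r + 1) hL))
    change Bar.mk _ _ _ (Cone.mk p (Set.projIcc 0 1 _ ((t : ℝ) - _))) = _
    rw [hL, MTree.slideErase_graft (by omega)]
    exact Bar.mk_graft_middle (by omega) (τ.slideErase t) ρ _ x y z _
  graft_last n m hm τ ρ x y p := by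
    have hL : (τ.graft 1 (n + 2) ρ : MTree (n + m + 2)).slideEraseLength =
      τ.slideEraseLength := MTree.slideEraseLength_graft (by omega) _ (by omega) _
    refine RelMooreLoop.ext (ContinuousMap.ext fun t => ?_)
      (NNReal.eq (congrArg (fun r : ℝ => r + 1) hL))
    change Bar.mk _ _ _ (Cone.mk p (Set.projIcc 0 1 _ ((t : ℝ) - _))) = _
    rw [hL, MTree.slideErase_graft (by omega)]
    -- The action on the cone keeps the cone coordinate, so the relation applies at all times at
    -- once.
    exact Bar.mk_graft_last (τ.slideErase t) ρ _ x y _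
  graft_first m n hm τ ρ x y p := by
    have hL : (τ.graft 1 1 ρ : MTree (m + n + 2)).slideEraseLength =
      ρ.slideLength + τ.slideEraseLength :=
      MTree.slideEraseLength_graft_one _ (by omega) (by omega) _
    have hτ := τ.slideEraseLength_nonneg (by omega)
    refine RelMooreLoop.ext (ContinuousMap.ext fun t => ?_) (NNReal.eq ?_)
    · change Bar.mk _ _ _ (Cone.mk p (Set.projIcc 0 1 _ ((t : ℝ) - _))) =
        if t ≤ (slideLoop S m ρ x).length then A.tipMap ((slideLoop S m ρ x).path t)
        else (slideConeLoop A n τ y p).path (t - (slideLoop S m ρ x).length)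
      rw [hL]
      split_ifs with h
      · have h' : (t : ℝ) ≤ ρ.slideLength := h
        rw [MTree.slideErase_graft_one_of_le _ (by omega) (by omega) (by omega) h',
          Cone.mk_projIcc_of_nonpos _ (by linarith)]
        -- Up to time l(ρ) the cone point is the tip, which the erased, turned-around `τ` fixes; the
        -- loop of `ρ` in the image of BX remains.
        exact (Bar.mk_graft_last (ρ.slide t) _ _ x y _).trans
          (congrArg (Bar.mk _ _ _) (Cone.mk_zero _))
      · have h' : ρ.slideLength ≤ t := le_of_not_ge h
        have e : ((t - (slideLoop S m ρ x).length : ℝ≥0) : ℝ) = t - ρ.slideLength :=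
          NNReal.coe_sub h'
        have e' : (t : ℝ) = ρ.slideLength + ((t - (slideLoop S m ρ x).length : ℝ≥0) : ℝ) := by
          rw [e]
          ring
        rw [e', MTree.slideErase_graft_one_add _ (by omega) (by omega) (by omega)
          (NNReal.coe_nonneg _), add_sub_add_left_eq_sub]
        exact Bar.mk_graft_first (τ.slideErase _) ρ _ x y _
    · change (τ.graft 1 1 ρ : MTree (m + n + 2)).slideEraseLength + 1 =
        ρ.slideLength + (τ.slideEraseLength + 1)
      rw [hL, add_assoc]

end

theorem mainTheorem5 {X P : Type u}
    [TopologicalSpace X] [T2Space X] [CompactlyGeneratedSpace X]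
    [TopologicalSpace P] [T2Space P] [CompactlyGeneratedSpace P] [Nonempty P]
    (S : AInftySpace X) (A : AInftyAction S P) :
    ∃ f : ∀ n : ℕ, MTree (n + 1) → (Fin n → X) →
        MooreLoop (ClassifyingSpace S) (ClassifyingSpace.base S),
      IsAInftyMap S f ∧
      IsUsualMap S (fun x => f 1 (MTree.corolla 2) fun _ => x) ∧
      (∀ n : ℕ, 1 ≤ n → ∀ (T : MTree (n + 1)) (x : Fin n → X),
        ((f n T x).length : ℝ) = T.slideLength ∧
        ∀ t : ℝ≥0, (f n T x).path t = Bar.mk (T.slide t) ⟨⟩ x ⟨⟩) ∧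
      IsAInftyMap S (fun n T x => MooreLoop.map A.tipMap (f n T x)) ∧
      ∃ F : ∀ n : ℕ, MTree (n + 2) → (Fin n → X) → P → A.OrbitRelLoop,
        IsAInftyEquivariance A (fun n T x => MooreLoop.map A.tipMap (f n T x)) A.gamma F ∧
        ∀ (n : ℕ) (T : MTree (n + 2)) (x : Fin n → X) (p : P),
          ((F n T x p).length : ℝ) = T.slideEraseLength + 1 ∧
          ∀ t : ℝ≥0, (F n T x p).path t =
            if (t : ℝ) ≤ T.slideEraseLength then Bar.mk (T.slideErase t) ⟨⟩ x (Cone.tip P)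
            else Bar.mk T ⟨⟩ x
              (Cone.mk p (Set.projIcc 0 1 zero_le_one ((t : ℝ) - T.slideEraseLength))) := by
  exact ⟨slideLoop S, isAInftyMap_slideLoop S, isUsualMap_slideLoop S,
    fun _ _ _ _ => ⟨rfl, fun _ => rfl⟩, (isAInftyMap_slideLoop S).map A.tipMap,
    slideConeLoop A, isAInftyEquivariance_slideConeLoop A,
    fun n T x p => ⟨rfl, slideConeLoop_path A n T x p⟩⟩
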